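/- **Proposition 3.6.** Let $0<\beta<1$, $x\ge 0$, $d\in\mathbb N$. Let $W$ be a standard $d$-dimensional Brownian motion on a probability space, let $X_x$ and $Q_x$ be the processes with continuous paths and $X_x(0)=Q_x(0)=0$ that solve $$dX_x(t)=-x\,X_x(t)\,dt+dW(t),\qquad dQ_x(t)=\big(-x\,Q_x(t)+X_x(t)\big)\,dt ,$$ and let $Y_\beta\ge 0$ be a random variable independent of $W$ with density $M_\beta$ on $[0,\infty)$, where $$M_\beta(z)=\sum_{n\ge 0}\frac{(-z)^n}{n!\,\Gamma(-\beta n+1-\beta)}$$ (with $1/\Gamma:=0$ at the poles of $\Gamma$). Put $W_x^\beta(t)=\sqrt{Y_\beta}\,Q_x(t)$ and $g_x(t,s)=\mathbf 1_{[0,t)}(s)\,(t-s)\,e^{-x(t-s)}$, and let $|g_x(t,\cdot)|$ denote the norm of $g_x(t,\cdot)$ in $L^2(\mathbb R)$. Then for all $t\ge 0$ and $k\in\mathbb R^d$ $$\mathbb E\big(e^{i(k,W_x^\beta(t))}\big)=E_\beta\Big(-\frac{|k|^2}{2}\,|g_x(t,\cdot)|^2\Big),\qquad E_\beta(z)=\sum_{n\ge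 0}\frac{z^n}{\Gamma(\beta n+1)} .$$ Moreover, for every $t>0$ the law of $W_x^\beta(t)$ has, with respect to Lebesgue measure $dy$ on $\mathbb R^d$, the density $$\rho_x(y,t)=(2\pi)^{-d/2}\cdot\frac12(4\pi)^{d/2}\,\mathbb M^d_{\beta/2}\big(\sqrt2\,y,\ |g_x(t,\cdot)|^{2/\beta}\big)$$ (that is, the density $\frac12(4\pi)^{d/2}\,\mathbb M^d_{\beta/2}(\sqrt2\,y,|g_x(t,\cdot)|^{2/\beta})$ with respect to the normalized Lebesgue measure $(2\pi)^{-d/2}dy$), where $$\mathbb M^d_{\beta/2}(z,r)=2\int_0^\infty \frac{e^{-|z|^2/(4\tau)}}{(4\pi\tau)^{d/2}}\,r^{-\beta}M_\beta(\tau r^{-\beta})\,d\tau ,$$ the integral at $(\sqrt2\,y,|g_x(t,\cdot)|^{2/\beta})$ converging absolutely for every $y\ne 0$. -/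

import Mathlib

open MeasureTheory ProbabilityTheory Set
open scoped NNReal ENNReal

noncomputable section

namespace GreyOU

/-- The Mittag-Leffler function `E_β(z) = ∑ zⁿ / Γ(β n + 1)`, as a function of `z ∈ ℂ`. -/
def mittagLeffler (β : ℝ) (z : ℂ) : ℂ :=
  ∑' n : ℕ, z ^ n / Complex.Gamma ((β : ℂ) * n + 1)

/-- The (one-variable) M-Wright function
`M_β(z) = ∑ (-z)ⁿ / (n! Γ(-β n + 1 - β))`, for a real argument. At the poles of `Γ` the coefficient
`1 / Γ` is read as `0`; since `Real.Gamma` takes the value `0` there, this is what division by zero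
gives. -/
def wrightM (β z : ℝ) : ℝ :=
  ∑' n : ℕ, (-z) ^ n / ((n.factorial : ℝ) * Real.Gamma (-β * n + 1 - β))

/-- The integrand of the subordination formula defining the `d`-dimensional M-Wright function:
`e^{-|x|²/(4τ)} (4πτ)^{-d/2} t^{-β} M_β(τ t^{-β})`. -/
def wrightKernel (β : ℝ) (d : ℕ) (x : EuclideanSpace ℝ (Fin d)) (t τ : ℝ) : ℝ :=
  Real.exp (-(‖x‖ ^ 2) / (4 * τ)) / (4 * Real.pi * τ) ^ ((d : ℝ) / 2)
    * (t ^ (-β) * wrightM β (τ * t ^ (-β)))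

/-- The `d`-dimensional two-variable M-Wright function `𝕄^d_{β/2}(x, t)`; the parameter is `β`,
not `β/2`. -/
def wrightMM (β : ℝ) (d : ℕ) (x : EuclideanSpace ℝ (Fin d)) (t : ℝ) : ℝ :=
  2 * ∫ τ in Ioi (0 : ℝ), wrightKernel β d x t τ

/-- The kernel `g_x(t, s) = 1_{[0,t)}(s) (t - s) e^{-x (t - s)}`. -/
def gKernel (x t s : ℝ) : ℝ :=
  (Ico (0 : ℝ) t).indicator (fun s => (t - s) * Real.exp (-x * (t - s))) s

/-- The norm of a real function in `L²(ℝ, ds)`. -/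
def l2Norm (f : ℝ → ℝ) : ℝ :=
  (eLpNorm f 2 volume).toReal

variable {Ω : Type*} [MeasurableSpace Ω]

/-- `W` is a standard `d`-dimensional Brownian motion: its coordinates are independent standard
real Brownian motions (started at `0`, with almost surely continuous paths). -/
structure IsBrownianMotion (P : Measure Ω) {d : ℕ}
    (W : ℝ≥0 → Ω → EuclideanSpace ℝ (Fin d)) : Prop where
  measurable : ∀ t, Measurable (W t)
  brownian : ∀ i, IsBrownianReal (fun t ω => W t ω i) P
  indep : iIndepFun (fun (i : Fin d) (ω : Ω) (t : ℝ≥0) => W t ω i) P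

/-- `X` is the Ornstein-Uhlenbeck process solving `dX(t) = -x X(t) dt + dW(t)`, `X(0) = 0`. As the
noise is additive, the equation is the following integral equation for continuous paths. -/
def IsOrnsteinUhlenbeck (P : Measure Ω) {d : ℕ} (x : ℝ)
    (W X : ℝ≥0 → Ω → EuclideanSpace ℝ (Fin d)) : Prop :=
  ∀ᵐ ω ∂P, Continuous (fun t => X t ω) ∧
    ∀ t : ℝ≥0, X t ω = (∫ s in (0 : ℝ)..t, (-x) • X s.toNNReal ω) + W t ω

/-- `Q` solves `dQ(t) = (-x Q(t) + X(t)) dt`, `Q(0) = 0`, along almost every path. -/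
def SolvesQEquation (P : Measure Ω) {d : ℕ} (x : ℝ)
    (X Q : ℝ≥0 → Ω → EuclideanSpace ℝ (Fin d)) : Prop :=
  ∀ᵐ ω ∂P, Continuous (fun t => Q t ω) ∧
    ∀ t : ℝ≥0, Q t ω = ∫ s in (0 : ℝ)..t, ((-x) • Q s.toNNReal ω + X s.toNNReal ω)

/-- The law on `[0, ∞)` with density `M_β` with respect to Lebesgue measure. -/
def wrightLaw (β : ℝ) : Measure ℝ :=
  (volume.restrict (Ici (0 : ℝ))).withDensity (fun τ => ENNReal.ofReal (wrightM β τ))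

end GreyOU

end

/-!
The process `Q_x` is the Wiener integral `∫₀ᵗ g_x(t, s) dW(s)`, so `Q_x(t)` is centred Gaussian with
covariance `v • 1`, `v = |g_x(t, ·)|²`. Conditioning on the independent variable `Y_β` gives
`E exp(i (k, √Y_β Q_x(t))) = E exp(-(|k|² v / 2) Y_β)`, and both claims come down to the Laplace
transform of `M_β`, which is `s ↦ E_β(-s)` (`mittagLeffler_eq_integral`).

*The Laplace transform.* The reflection formula and Euler's integral over a ray `t e^{iθ}`, with
`π / 2 < θ < π` and `β θ < π / 2`, turn the series of `M_β` into
`M_β(z) = π⁻¹ Im ∫ e^ζ ζ^(β - 1) exp(-z ζ^β) dζ` (`wrightM_eq_ray`). Two consequences are drawn.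
By Fubini, the Mellin transform of `M_β` at `s ∈ (0, 1)` is `Γ(s) / Γ(1 - β + β s)`. And the
starting point of the ray may be moved from `0` to any `c > 0`, since this adds an integral over a
real segment, where the integrand is real; on the new contour `|ζ|` is bounded below, so that
`M_β(z) = O(e^{-r z})` for every `r` (`exists_abs_wrightM_le`). The Mellin transform is therefore
holomorphic on the right half-plane, and the identity theorem extends the formula to `s = n + 1`:
the moments of `M_β` are `n! / Γ(β n + 1)`, and the exponential series may be integrated termwise.

*Positivity.* That `M_β` is nonnegative follows from `∫ M_β = 1` and from the positive part of
`M_β` being the density of the law of `Y_β`, which has mass `1` (`wrightM_nonneg`).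

*The Gaussian part.* Variation of constants gives `Q_x(t) = -∫₀ᵗ ∂ₛg_x(t, s) W(s) ds` along almost
every path. By Abel summation this is the limit of the left-point sums `stochSum`, whose
characteristic functions are explicit because increments and coordinates are independent.

*The density.* The density claimed is a mixture of heat kernels over `τ = v Y_β` (`density_eq`); its
characteristic function is computed by Fubini, and a finite measure is determined by it.
-/

namespace GreyOU
open Filter Topology

/-! ### Euler's integral over a ray -/

theorem integrableOn_rpow_sub_one_mul_exp_neg {a c : ℝ} (ha : 0 < a) (hc : 0 < c) :
    IntegrableOn (fun t : ℝ => t ^ (a - 1) * Real.exp (-(c * t))) (Ioi 0) := by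
  have h := integrableOn_rpow_mul_exp_neg_mul_rpow (s := a - 1) (p := 1) (b := c)
    (by linarith) one_pos hc
  simpa using h

/-- Euler's integral with a complex rate `r`: both sides are holomorphic on the right half-plane
and agree for real `r`. -/
theorem integral_rpow_mul_cexp_neg_mul_Ioi {a : ℝ} (ha : 0 < a) {r : ℂ} (hr : 0 < r.re) :
    ∫ t in Ioi (0 : ℝ), ((t ^ (a - 1) : ℝ) : ℂ) * Complex.exp (-(r * t))
      = Real.Gamma a * r ^ (-(a : ℂ)) := by
  set μ : Measure ℝ := (volume.restrict (Ioi 0)).withDensity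
    (fun t => ENNReal.ofReal (t ^ (a - 1))) with hμ
  have hmeas : Measurable (fun t : ℝ => ENNReal.ofReal (t ^ (a - 1))) := by fun_prop
  have key : ∀ z : ℂ, complexMGF id μ z
      = ∫ t in Ioi (0 : ℝ), ((t ^ (a - 1) : ℝ) : ℂ) * Complex.exp (z * t) := by
    intro z
    rw [complexMGF, hμ, integral_withDensity_eq_integral_toReal_smul hmeas
      (ae_of_all _ fun t => ENNReal.ofReal_lt_top)]
    refine setIntegral_congr_fun measurableSet_Ioi fun t ht => ?_
    have ht' : (0 : ℝ) < t := ht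
    simp only [id, ENNReal.toReal_ofReal (Real.rpow_nonneg ht'.le _), Complex.real_smul]
  have hsub : Iio (0 : ℝ) ⊆ interior (integrableExpSet id μ) := by
    refine interior_maximal (fun s hs => ?_) isOpen_Iio
    have hs' : s < 0 := hs
    change Integrable (fun t => Real.exp (s * id t)) μ
    rw [hμ, integrable_withDensity_iff_integrable_smul' hmeas
      (ae_of_all _ fun t => ENNReal.ofReal_lt_top)]
    refine (integrableOn_rpow_sub_one_mul_exp_neg ha (neg_pos.2 hs')).congr_fun
      (fun t ht => ?_) measurableSet_Ioi
    have ht' : (0 : ℝ) < t := ht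
    simp [ENNReal.toReal_ofReal (Real.rpow_nonneg ht'.le _)]
  have hU : IsOpen {z : ℂ | z.re < 0} := isOpen_lt Complex.continuous_re continuous_const
  have h1 : AnalyticOnNhd ℂ (complexMGF id μ) {z | z.re < 0} :=
    fun z hz => analyticOnNhd_complexMGF z (hsub hz)
  have h2 : AnalyticOnNhd ℂ (fun z : ℂ => (Real.Gamma a : ℂ) * (-z) ^ (-(a : ℂ)))
      {z | z.re < 0} := by
    refine DifferentiableOn.analyticOnNhd (fun z hz => ?_) hU
    have hz' : z.re < 0 := hz
    refine DifferentiableAt.differentiableWithinAt ?_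
    refine (differentiableAt_const _).mul (DifferentiableAt.cpow_const differentiableAt_id.neg ?_)
    left; simpa using hz'
  have h3 : EqOn (complexMGF id μ) (fun z : ℂ => (Real.Gamma a : ℂ) * (-z) ^ (-(a : ℂ)))
      {z | z.re < 0} := by
    refine h1.eqOn_of_preconnected_of_frequently_eq h2
      (convex_halfSpace_re_lt 0).isPreconnected (z₀ := ((-1 : ℝ) : ℂ)) (by simp) ?_
    have hreal : ∀ x : ℝ, x < 0 → complexMGF id μ x
        = (Real.Gamma a : ℂ) * (-(x : ℂ)) ^ (-(a : ℂ)) := by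
      intro x hx
      have hx' : 0 < -x := by linarith
      have := Real.integral_rpow_mul_exp_neg_mul_Ioi ha hx'
      rw [key, ← Complex.ofReal_neg, ← Complex.ofReal_neg, ← Complex.ofReal_cpow hx'.le,
        ← Complex.ofReal_mul, mul_comm (Real.Gamma a), Real.rpow_neg hx'.le,
        ← Real.inv_rpow hx'.le, ← one_div, ← this, ← integral_complex_ofReal]
      refine setIntegral_congr_fun measurableSet_Ioi fun t ht => ?_
      push_cast
      ring_nf
    have hx : Tendsto (fun n : ℕ => ((-1 : ℝ) - 1 / ((n : ℝ) + 1))) atTop (𝓝 (-1)) := by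
      simpa using tendsto_const_nhds.sub (tendsto_one_div_add_atTop_nhds_zero_nat (𝕜 := ℝ))
    rw [frequently_iff_seq_forall]
    refine ⟨fun n : ℕ => (((-1 : ℝ) - 1 / ((n : ℝ) + 1) : ℝ) : ℂ), ?_, fun n => hreal _ ?_⟩
    · rw [tendsto_nhdsWithin_iff]
      refine ⟨(Complex.continuous_ofReal.tendsto _).comp hx, Eventually.of_forall fun n => ?_⟩
      have : (0 : ℝ) < 1 / ((n : ℝ) + 1) := by positivity
      simp only [mem_compl_iff, mem_singleton_iff, Complex.ofReal_inj]
      linarith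
    · have : (0 : ℝ) < 1 / ((n : ℝ) + 1) := by positivity
      linarith
  have := h3 (show (-r).re < 0 by simpa using hr)
  rw [key] at this
  simpa using this

/-- Euler's integral with the contour turned to the ray `t e^{iθ}`, on which the integrand decays
because `cos θ < 0`. The imaginary part of the right side is `π / Γ(1 - a)`, see
`inv_Gamma_one_sub`. -/
theorem integral_rpow_mul_cexp_ray {a θ : ℝ} (ha : 0 < a) (hθ : θ ∈ Ioo (Real.pi / 2) Real.pi) :
    ∫ t in Ioi (0 : ℝ), ((t ^ (a - 1) : ℝ) : ℂ)
        * Complex.exp (a * θ * Complex.I + t * Complex.exp (θ * Complex.I))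
      = Real.Gamma a * Complex.exp (Real.pi * a * Complex.I) := by
  have hre : 0 < (-Complex.exp (θ * Complex.I)).re := by
    rw [Complex.neg_re, Complex.exp_ofReal_mul_I_re]
    have := Real.cos_neg_of_pi_div_two_lt_of_lt hθ.1 (by linarith [hθ.2, Real.pi_pos])
    linarith
  have h := integral_rpow_mul_cexp_neg_mul_Ioi ha hre
  have hr : -Complex.exp (θ * Complex.I) = Complex.exp (((θ - Real.pi : ℝ) : ℂ) * Complex.I) := by
    push_cast
    rw [sub_mul, Complex.exp_sub, Complex.exp_pi_mul_I]
    rw [div_neg, div_one]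
  have hlog : Complex.log (-Complex.exp (θ * Complex.I)) = ((θ - Real.pi : ℝ) : ℂ) * Complex.I := by
    rw [hr, Complex.log_exp] <;> simp <;> linarith [hθ.1, hθ.2, Real.pi_pos]
  rw [Complex.cpow_def_of_ne_zero (by intro h0; rw [h0] at hre; simp at hre), hlog] at h
  have : ∀ t : ℝ, ((t ^ (a - 1) : ℝ) : ℂ)
        * Complex.exp (a * θ * Complex.I + t * Complex.exp (θ * Complex.I))
      = Complex.exp (a * θ * Complex.I) * (((t ^ (a - 1) : ℝ) : ℂ)
        * Complex.exp (-(-Complex.exp (θ * Complex.I) * t))) := by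
    intro t
    rw [Complex.exp_add]
    ring_nf
  simp_rw [this]
  rw [integral_const_mul, h, mul_left_comm, ← Complex.exp_add]
  congr 2
  push_cast
  ring

/-- The reflection formula, solved for `1 / Γ(1 - a)`. It persists at the poles of `Γ(1 - a)`, where
both sides are `0`. -/
theorem inv_Gamma_one_sub {a : ℝ} (ha : 0 < a) :
    (Real.Gamma (1 - a))⁻¹ = Real.Gamma a * Real.sin (Real.pi * a) / Real.pi := by
  have h := Real.Gamma_mul_Gamma_one_sub a
  have hG := (Real.Gamma_pos_of_pos ha).ne'
  by_cases hs : Real.sin (Real.pi * a) = 0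
  · rw [hs, div_zero] at h
    simp [hs, (mul_eq_zero.1 h).resolve_left hG]
  · have hne : Real.Gamma (1 - a) ≠ 0 := by
      intro h0
      rw [h0, mul_zero, eq_comm, div_eq_zero_iff] at h
      exact h.elim Real.pi_ne_zero hs
    rw [eq_div_iff hs] at h
    rw [inv_eq_one_div, div_eq_div_iff hne Real.pi_ne_zero, one_mul]
    linarith

/-! ### The ray representation of the M-Wright function -/

/-- For `β < 1` the term `b t ^ β` is dominated by `c t / 2` up to a constant. -/
theorem integrableOn_exp_add_rpow {β b c : ℝ} (hβ : 0 < β) (hβ' : β < 1) (hc : 0 < c) (hb : 0 ≤ b) :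
    IntegrableOn (fun t : ℝ => t ^ (β - 1) * Real.exp (-(c * t) + b * t ^ β)) (Ioi 0) := by
  obtain ⟨T, hT0, hT⟩ : ∃ T : ℝ, 0 < T ∧ b * T ^ (β - 1) ≤ c / 2 := by
    have h1 : Tendsto (fun T : ℝ => b * T ^ (-(1 - β))) atTop (𝓝 (b * 0)) :=
      (tendsto_rpow_neg_atTop (by linarith)).const_mul b
    rw [mul_zero] at h1
    have h2 := (h1.eventually_lt_const (half_pos hc)).and (eventually_gt_atTop 0)
    obtain ⟨T, hT, hT0⟩ := h2.exists
    exact ⟨T, hT0, by rw [neg_sub] at hT; exact hT.le⟩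
  have hbound : ∀ t : ℝ, 0 < t → b * t ^ β ≤ c / 2 * t + b * T ^ β := by
    intro t ht
    rcases le_total t T with h | h
    · have : b * t ^ β ≤ b * T ^ β := by gcongr
      have : 0 ≤ c / 2 * t := by positivity
      linarith
    · have h3 : t ^ (β - 1) ≤ T ^ (β - 1) :=
        Real.rpow_le_rpow_of_nonpos hT0 h (by linarith)
      have h4 : t ^ β = t ^ (β - 1) * t := by
        rw [← Real.rpow_add_one ht.ne']; ring_nf
      have h5 : b * t ^ β ≤ c / 2 * t := by
        rw [h4, ← mul_assoc]
        gcongr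
        exact (mul_le_mul_of_nonneg_left h3 hb).trans hT
      have : 0 ≤ b * T ^ β := by positivity
      linarith
  have hint := (integrableOn_rpow_sub_one_mul_exp_neg hβ (half_pos hc)).mul_const
    (Real.exp (b * T ^ β))
  refine Integrable.mono' hint (by fun_prop) ?_
  filter_upwards [ae_restrict_mem measurableSet_Ioi] with t ht
  have ht' : (0 : ℝ) < t := ht
  rw [Real.norm_of_nonneg (by positivity), mul_assoc, ← Real.exp_add]
  refine mul_le_mul_of_nonneg_left (Real.exp_le_exp.2 ?_) (by positivity)
  linarith [hbound t ht']

/-- The integrand of the ray representation of `M_β(z)`: the value of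
`e^ζ ζ^(β - 1) exp(-z ζ^β) dζ` at `ζ = t e^{iθ}`, `dζ = e^{iθ} dt`, with the powers of `ζ` written
out in terms of real powers of `t`. -/
noncomputable def rayIntegrand (β θ z t : ℝ) : ℂ :=
  ((t ^ (β - 1) : ℝ) : ℂ) * Complex.exp (β * θ * Complex.I + t * Complex.exp (θ * Complex.I)
    - z * ((t ^ β : ℝ) : ℂ) * Complex.exp (β * θ * Complex.I))

/-- The ray representation of `M_β`, obtained by writing each coefficient `1 / Γ(1 - β(n + 1))` as
Euler's integral over the ray and summing the exponential series under the integral. -/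
theorem wrightM_eq_ray {β θ : ℝ} (hβ : 0 < β) (hβ' : β < 1)
    (hθ : θ ∈ Ioo (Real.pi / 2) Real.pi) (z : ℝ) :
    wrightM β z = (∫ t in Ioi (0 : ℝ), rayIntegrand β θ z t).im / Real.pi := by
  have hcos : Real.cos θ < 0 :=
    Real.cos_neg_of_pi_div_two_lt_of_lt hθ.1 (by linarith [hθ.2, Real.pi_pos])
  set F : ℕ → ℝ → ℂ := fun n t => ((-z : ℂ) ^ n / n.factorial) *
    (((t ^ (β * (n + 1) - 1) : ℝ) : ℂ) * Complex.exp ((β * (n + 1) : ℝ) * θ * Complex.I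
      + t * Complex.exp (θ * Complex.I))) with hF
  have hnorm : ∀ n t, 0 < t → ‖F n t‖ = t ^ (β - 1) * Real.exp (-(-Real.cos θ * t))
      * ((|z| * t ^ β) ^ n / n.factorial) := by
    intro n t ht
    have e1 : t ^ (β * (n + 1) - 1) = t ^ (β - 1) * (t ^ β) ^ n := by
      rw [← Real.rpow_natCast, ← Real.rpow_mul ht.le, ← Real.rpow_add ht]; ring_nf
    simp only [hF, norm_mul, norm_div, norm_pow, norm_neg, Complex.norm_real, Complex.norm_exp,
      Complex.norm_natCast, Real.norm_eq_abs]
    rw [e1, abs_of_nonneg (show 0 ≤ t ^ (β - 1) * (t ^ β) ^ n by positivity)]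
    have e2 : (((β * (n + 1) : ℝ) : ℂ) * θ * Complex.I + t * Complex.exp (θ * Complex.I)).re
        = -(-Real.cos θ * t) := by
      rw [Complex.add_re, Complex.re_ofReal_mul, Complex.exp_ofReal_mul_I_re,
        ← Complex.ofReal_mul, Complex.re_ofReal_mul, Complex.I_re]
      ring
    rw [e2, mul_pow]
    ring
  have hsumn : ∀ t, HasSum (fun n : ℕ => (|z| * t ^ β) ^ n / n.factorial)
      (Real.exp (|z| * t ^ β)) := fun t => by
    rw [Real.exp_eq_exp_ℝ]; exact NormedSpace.expSeries_div_hasSum_exp _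
  have hsum : HasSum (fun n => ∫ t in Ioi (0 : ℝ), F n t)
      (∫ t in Ioi (0 : ℝ), rayIntegrand β θ z t) := by
    refine hasSum_integral_of_dominated_convergence
      (fun n t => t ^ (β - 1) * Real.exp (-(-Real.cos θ * t))
        * ((|z| * t ^ β) ^ n / n.factorial)) (fun n => ?_) (fun n => ?_) ?_ ?_ ?_
    · have : Measurable (F n) := by simp only [hF]; fun_prop
      exact this.aestronglyMeasurable
    · filter_upwards [ae_restrict_mem measurableSet_Ioi] with t ht using (hnorm n t ht).le
    · exact ae_of_all _ fun t => (hsumn t).summable.mul_left _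
    · have := integrableOn_exp_add_rpow hβ hβ' (neg_pos.2 hcos) (abs_nonneg z)
      refine this.congr_fun (fun t ht => ?_) measurableSet_Ioi
      simp only [tsum_mul_left, (hsumn t).tsum_eq, Real.exp_add, mul_assoc]
    · filter_upwards [ae_restrict_mem measurableSet_Ioi] with t ht
      have ht' : (0 : ℝ) < t := ht
      have h1 : HasSum (fun n : ℕ => (-(z * ((t ^ β : ℝ) : ℂ)
          * Complex.exp (β * θ * Complex.I))) ^ n / n.factorial)
          (Complex.exp (-(z * ((t ^ β : ℝ) : ℂ) * Complex.exp (β * θ * Complex.I)))) := by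
        rw [Complex.exp_eq_exp_ℂ]; exact NormedSpace.expSeries_div_hasSum_exp _
      have h2 := h1.mul_left (((t ^ (β - 1) : ℝ) : ℂ) * Complex.exp (β * θ * Complex.I
        + t * Complex.exp (θ * Complex.I)))
      rw [mul_assoc ((t ^ (β - 1) : ℝ) : ℂ), ← Complex.exp_add, ← sub_eq_add_neg] at h2
      refine h2.congr_fun fun n => ?_
      have e1 : t ^ (β * (n + 1) - 1) = t ^ (β - 1) * (t ^ β) ^ n := by
        rw [← Real.rpow_natCast, ← Real.rpow_mul ht'.le, ← Real.rpow_add ht']; ring_nf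
      have e2 : Complex.exp ((β * (n + 1) : ℝ) * θ * Complex.I + t * Complex.exp (θ * Complex.I))
          = Complex.exp (β * θ * Complex.I + t * Complex.exp (θ * Complex.I))
            * Complex.exp (β * θ * Complex.I) ^ n := by
        rw [← Complex.exp_nat_mul, ← Complex.exp_add]
        congr 1; push_cast; ring
      simp only [hF, e1, e2]
      push_cast
      rw [neg_pow (z : ℂ), neg_pow (z * ((t ^ β : ℝ) : ℂ) * _), mul_pow, mul_pow]
      ring
  have hterm : ∀ n : ℕ, (∫ t in Ioi (0 : ℝ), F n t).im / Real.pi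
      = (-z) ^ n / ((n.factorial : ℝ) * Real.Gamma (-β * n + 1 - β)) := by
    intro n
    have ha : 0 < β * (n + 1) := by positivity
    have hG : Real.Gamma (-β * n + 1 - β) = Real.Gamma (1 - β * (n + 1)) := by ring_nf
    simp only [hF]
    rw [integral_const_mul, integral_rpow_mul_cexp_ray ha hθ, hG, div_mul_eq_div_div,
      div_eq_mul_inv _ (Real.Gamma _), inv_Gamma_one_sub ha]
    have : ((-z : ℂ) ^ n / n.factorial) = (((-z) ^ n / n.factorial : ℝ) : ℂ) := by push_cast; rfl
    rw [this, Complex.im_ofReal_mul, Complex.im_ofReal_mul, ← Complex.ofReal_mul,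
      Complex.exp_ofReal_mul_I_im]
    ring
  have him := (Complex.hasSum_im hsum).div_const Real.pi
  simp only [hterm] at him
  exact him.tsum_eq

/-! ### Moving the contour away from the origin -/

/-- The point `c + t e^{iθ}` of the ray from `c` in direction `e^{iθ}`. -/
noncomputable def rayPoint (θ c t : ℝ) : ℂ := c + t * Complex.exp (θ * Complex.I)

/-- The contour integrand `e^ζ ζ^(β - 1) exp(-z ζ^β)`, holomorphic on the slit plane. -/
noncomputable def wrightIntegrand (β z : ℝ) (ζ : ℂ) : ℂ :=
  Complex.exp ζ * ζ ^ ((β : ℂ) - 1) * Complex.exp (-(z * ζ ^ (β : ℂ)))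

section RayPoint
variable {θ c t : ℝ}

theorem rayPoint_re : (rayPoint θ c t).re = c + t * Real.cos θ := by
  simp [rayPoint, Complex.exp_ofReal_mul_I_re]

theorem rayPoint_im : (rayPoint θ c t).im = t * Real.sin θ := by
  simp [rayPoint, Complex.exp_ofReal_mul_I_im]

theorem mul_sin_le_norm_rayPoint : t * Real.sin θ ≤ ‖rayPoint θ c t‖ := by
  rw [← rayPoint_im (c := c)]
  exact (le_abs_self _).trans (Complex.abs_im_le_norm _)

/-- The distance from `0` to the line through `c` in direction `e^{iθ}` is `c sin θ`. -/
theorem mul_sin_le_norm_rayPoint' : c * Real.sin θ ≤ ‖rayPoint θ c t‖ := by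
  -- Turning by `-θ` makes the height over the line visible as an imaginary part.
  have h : ‖rayPoint θ c t‖ = ‖rayPoint (-θ) t c‖ := by
    have : rayPoint θ c t = rayPoint (-θ) t c * Complex.exp (θ * Complex.I) := by
      simp only [rayPoint, add_mul, mul_assoc, ← Complex.exp_add]
      simp [add_comm]
    rw [this, norm_mul, Complex.norm_exp_ofReal_mul_I, mul_one]
  have h2 := Complex.abs_im_le_norm (rayPoint (-θ) t c)
  rw [rayPoint_im, Real.sin_neg, mul_neg, abs_neg] at h2
  rw [h]
  exact (le_abs_self _).trans h2

variable (hθ : θ ∈ Ioo (Real.pi / 2) Real.pi)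
include hθ

theorem sin_pos_of_obtuse : 0 < Real.sin θ :=
  Real.sin_pos_of_pos_of_lt_pi (by linarith [hθ.1, Real.pi_pos]) hθ.2

theorem cos_neg_of_obtuse : Real.cos θ < 0 :=
  Real.cos_neg_of_pi_div_two_lt_of_lt hθ.1 (by linarith [hθ.2, Real.pi_pos])

theorem rayPoint_mem_slitPlane (ht : 0 ≤ t) (h : 0 < c ∨ 0 < t) :
    rayPoint θ c t ∈ Complex.slitPlane := by
  rcases ht.eq_or_lt with rfl | ht
  · left
    rw [rayPoint_re]
    simpa using h
  · right
    rw [rayPoint_im]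
    exact (mul_pos ht (sin_pos_of_obtuse hθ)).ne'

theorem arg_rayPoint_mem (hc : 0 ≤ c) (ht : 0 ≤ t) (h : 0 < c ∨ 0 < t) :
    Complex.arg (rayPoint θ c t) ∈ Icc 0 θ := by
  have hs := sin_pos_of_obtuse hθ
  have hcos := cos_neg_of_obtuse hθ
  have hne : rayPoint θ c t ≠ 0 :=
    Complex.slitPlane_ne_zero (rayPoint_mem_slitPlane hθ ht h)
  have h0 : 0 ≤ Complex.arg (rayPoint θ c t) :=
    Complex.arg_nonneg_iff.2 (by rw [rayPoint_im]; positivity)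
  refine ⟨h0, ?_⟩
  by_contra! hlt
  have h1 : Real.cos (Complex.arg (rayPoint θ c t)) < Real.cos θ :=
    Real.cos_lt_cos_of_nonneg_of_le_pi (by linarith [hθ.1, Real.pi_pos]) (Complex.arg_le_pi _) hlt
  rw [Complex.cos_arg hne, div_lt_iff₀ (norm_pos_iff.2 hne), rayPoint_re] at h1
  have h2 : ‖rayPoint θ c t‖ ≥ t - c := by
    have : ‖(t : ℂ) * Complex.exp (θ * Complex.I)‖ ≤ ‖rayPoint θ c t‖ + ‖(c : ℂ)‖ := by
      refine le_trans (le_of_eq ?_) (norm_sub_le (rayPoint θ c t) c)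
      simp [rayPoint]
    rw [norm_mul, Complex.norm_exp_ofReal_mul_I, mul_one, Complex.norm_real, Complex.norm_real,
      Real.norm_of_nonneg ht, Real.norm_of_nonneg hc] at this
    linarith
  have h3 : c * (1 + Real.cos θ) ≥ 0 := mul_nonneg hc (by linarith [Real.neg_one_le_cos θ])
  nlinarith [mul_nonneg (sub_nonneg.2 h2) (neg_nonneg.2 hcos.le)]

/-- As `arg ζ ∈ [0, θ]` on the ray and `β θ < π / 2`, the real part of `ζ^β` is at least
`cos (β θ) ‖ζ‖^β`. -/
theorem norm_wrightIntegrand_le {β z : ℝ} (hβ : 0 < β) (hβθ : β * θ < Real.pi / 2) (hz : 0 ≤ z)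
    (hc : 0 ≤ c) (ht : 0 ≤ t) (h : 0 < c ∨ 0 < t) :
    ‖wrightIntegrand β z (rayPoint θ c t)‖ ≤ Real.exp (c + t * Real.cos θ)
      * ‖rayPoint θ c t‖ ^ (β - 1)
      * Real.exp (-(z * (‖rayPoint θ c t‖ ^ β * Real.cos (β * θ)))) := by
  obtain ⟨ha0, ha1⟩ := arg_rayPoint_mem hθ hc ht h
  have hne : rayPoint θ c t ≠ 0 :=
    Complex.slitPlane_ne_zero (rayPoint_mem_slitPlane hθ ht h)
  have h1 : ((β : ℂ) - 1) = ((β - 1 : ℝ) : ℂ) := by push_cast; rfl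
  rw [wrightIntegrand, norm_mul, norm_mul, Complex.norm_exp, Complex.norm_exp, rayPoint_re, h1,
    Complex.norm_cpow_real, Complex.neg_re, Complex.re_ofReal_mul, Complex.cpow_ofReal_re]
  gcongr
  refine Real.cos_le_cos_of_nonneg_of_le_pi (by positivity) (by linarith [Real.pi_pos]) ?_
  rw [mul_comm]
  gcongr

end RayPoint

section Shift
variable {β θ z : ℝ}

theorem exp_mul_wrightIntegrand_ray (hθ : θ ∈ Ioo (Real.pi / 2) Real.pi) {t : ℝ} (ht : 0 < t) :
    Complex.exp (θ * Complex.I) * wrightIntegrand β z (rayPoint θ 0 t) = rayIntegrand β θ z t := by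
  have h0 : rayPoint θ 0 t = t * Complex.exp (θ * Complex.I) := by simp [rayPoint]
  have hlog : Complex.log (t * Complex.exp (θ * Complex.I)) = Real.log t + θ * Complex.I := by
    rw [Complex.log_ofReal_mul ht (Complex.exp_ne_zero _), Complex.log_exp] <;>
      rw [Complex.im_ofReal_mul, Complex.I_im] <;> linarith [hθ.1, hθ.2, Real.pi_pos]
  have hne : (t : ℂ) * Complex.exp (θ * Complex.I) ≠ 0 :=
    mul_ne_zero (by exact_mod_cast ht.ne') (Complex.exp_ne_zero _)
  rw [rayIntegrand, wrightIntegrand, h0, Complex.cpow_def_of_ne_zero hne,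
    Complex.cpow_def_of_ne_zero hne, hlog, Real.rpow_def_of_pos ht, Real.rpow_def_of_pos ht]
  push_cast
  rw [← Complex.exp_add, ← Complex.exp_add, ← Complex.exp_add, ← Complex.exp_add, mul_assoc (z : ℂ),
    ← Complex.exp_add]
  congr 1
  ring_nf

theorem hasDerivAt_wrightIntegrand {ζ : ℂ} (hζ : ζ ∈ Complex.slitPlane) :
    HasDerivAt (wrightIntegrand β z)
      ((1 + (β - 1) / ζ - z * β * ζ ^ ((β : ℂ) - 1)) * wrightIntegrand β z ζ) ζ := by
  have h0 := Complex.slitPlane_ne_zero hζ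
  have h1 : HasDerivAt (fun ζ : ℂ => ζ ^ ((β : ℂ) - 1)) _ ζ :=
    (hasDerivAt_id ζ).cpow_const hζ
  have h2 : HasDerivAt (fun ζ : ℂ => ζ ^ (β : ℂ)) _ ζ := (hasDerivAt_id ζ).cpow_const hζ
  have h3 := ((Complex.hasDerivAt_exp ζ).mul h1).mul ((h2.const_mul (z : ℂ)).neg.cexp)
  refine h3.congr_deriv ?_
  simp only [id, wrightIntegrand, Pi.mul_apply, Pi.neg_apply, mul_one]
  rw [Complex.cpow_sub ((β : ℂ) - 1) 1 h0, Complex.cpow_one]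
  ring

theorem continuousOn_wrightIntegrand_ray (hθ : θ ∈ Ioo (Real.pi / 2) Real.pi) (c : ℝ) :
    ContinuousOn (fun t => wrightIntegrand β z (rayPoint θ c t)) (Ioi 0) := by
  intro t ht
  have h := rayPoint_mem_slitPlane (c := c) hθ (le_of_lt ht) (Or.inr ht)
  refine ContinuousAt.continuousWithinAt ?_
  have h1 : ContinuousAt (rayPoint θ c) t := by unfold rayPoint; fun_prop
  unfold wrightIntegrand
  exact ((h1.cexp).mul (h1.cpow continuousAt_const h)).mul
    ((continuousAt_const.mul (h1.cpow continuousAt_const h)).neg.cexp)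

variable (hβ : 0 < β) (hβ' : β < 1) (hθ : θ ∈ Ioo (Real.pi / 2) Real.pi)
  (hβθ : β * θ < Real.pi / 2)
include hβ hβ' hθ hβθ

/-- A bound that is uniform in `c ∈ [0, C]`, integrable although singular at `t = 0`. -/
theorem norm_wrightIntegrand_le_rpow (hz : 0 ≤ z) {c C t : ℝ} (hc : 0 ≤ c) (hC : c ≤ C)
    (ht : 0 < t) :
    ‖wrightIntegrand β z (rayPoint θ c t)‖ ≤
      Real.exp C * Real.sin θ ^ (β - 1) * (t ^ (β - 1) * Real.exp (-(-Real.cos θ * t))) := by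
  have hs := sin_pos_of_obtuse hθ
  have hcos : 0 < Real.cos (β * θ) := Real.cos_pos_of_mem_Ioo
    ⟨by nlinarith [hθ.1, Real.pi_pos], hβθ⟩
  have h1 := norm_wrightIntegrand_le hθ hβ hβθ hz hc ht.le (Or.inr ht)
  have h2 : ‖rayPoint θ c t‖ ^ (β - 1) ≤ (t * Real.sin θ) ^ (β - 1) :=
    Real.rpow_le_rpow_of_nonpos (by positivity) mul_sin_le_norm_rayPoint (by linarith)
  have h3 : Real.exp (-(z * (‖rayPoint θ c t‖ ^ β * Real.cos (β * θ)))) ≤ 1 :=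
    Real.exp_le_one_iff.2 (neg_nonpos.2 (by positivity))
  have h4 : Real.exp (c + t * Real.cos θ) ≤ Real.exp C * Real.exp (-(-Real.cos θ * t)) := by
    rw [← Real.exp_add]
    exact Real.exp_le_exp.2 (by linarith)
  calc _ ≤ _ := h1
    _ ≤ (Real.exp C * Real.exp (-(-Real.cos θ * t))) * (t * Real.sin θ) ^ (β - 1) * 1 := by gcongr
    _ = _ := by rw [Real.mul_rpow ht.le hs.le]; ring

/-- A bound that decays exponentially in `z`, valid for rays that start at distance at least `m > 0`
from the origin. -/
theorem norm_wrightIntegrand_le_exp (hz : 0 ≤ z) {m c C t : ℝ} (hm : 0 < m) (hc : m ≤ c)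
    (hC : c ≤ C) (ht : 0 ≤ t) :
    ‖wrightIntegrand β z (rayPoint θ c t)‖ ≤
      Real.exp C * (m * Real.sin θ) ^ (β - 1)
        * Real.exp (-(z * ((m * Real.sin θ) ^ β * Real.cos (β * θ))))
        * Real.exp (-(-Real.cos θ * t)) := by
  have hs := sin_pos_of_obtuse hθ
  have hcos : 0 < Real.cos (β * θ) := Real.cos_pos_of_mem_Ioo
    ⟨by nlinarith [hθ.1, Real.pi_pos], hβθ⟩
  have h1 := norm_wrightIntegrand_le hθ hβ hβθ hz (hm.le.trans hc) ht (Or.inl (hm.trans_le hc))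
  have h0 : m * Real.sin θ ≤ ‖rayPoint θ c t‖ :=
    le_trans (by gcongr) mul_sin_le_norm_rayPoint'
  have h2 : ‖rayPoint θ c t‖ ^ (β - 1) ≤ (m * Real.sin θ) ^ (β - 1) :=
    Real.rpow_le_rpow_of_nonpos (by positivity) h0 (by linarith)
  have h3 : Real.exp (-(z * (‖rayPoint θ c t‖ ^ β * Real.cos (β * θ))))
      ≤ Real.exp (-(z * ((m * Real.sin θ) ^ β * Real.cos (β * θ)))) := by gcongr
  have h4 : Real.exp (c + t * Real.cos θ) ≤ Real.exp C * Real.exp (-(-Real.cos θ * t)) := by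
    rw [← Real.exp_add]
    exact Real.exp_le_exp.2 (by linarith)
  calc _ ≤ _ := h1
    _ ≤ (Real.exp C * Real.exp (-(-Real.cos θ * t))) * (m * Real.sin θ) ^ (β - 1)
        * Real.exp (-(z * ((m * Real.sin θ) ^ β * Real.cos (β * θ)))) := by gcongr
    _ = _ := by ring

theorem integrableOn_wrightIntegrand_ray (hz : 0 ≤ z) {c : ℝ} (hc : 0 ≤ c) :
    IntegrableOn (fun t => wrightIntegrand β z (rayPoint θ c t)) (Ioi 0) := by
  have h := (integrableOn_rpow_sub_one_mul_exp_neg hβ (neg_pos.2 (cos_neg_of_obtuse hθ))).const_mul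
    (Real.exp c * Real.sin θ ^ (β - 1))
  refine Integrable.mono' h
    ((continuousOn_wrightIntegrand_ray hθ c).aestronglyMeasurable measurableSet_Ioi) ?_
  filter_upwards [ae_restrict_mem measurableSet_Ioi] with t ht
  exact norm_wrightIntegrand_le_rpow hβ hβ' hθ hβθ hz hc le_rfl ht

/-- Moving the starting point of the ray: the derivative in `c` of the integrand is its derivative
along the ray, so only the boundary term at `t = 0` remains. -/
theorem integral_wrightIntegrand_ray_hasDerivAt (hz : 0 ≤ z) {c : ℝ} (hc : 0 < c) :
    HasDerivAt (fun c => ∫ t in Ioi (0 : ℝ),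
        Complex.exp (θ * Complex.I) * wrightIntegrand β z (rayPoint θ c t))
      (-wrightIntegrand β z c) c := by
  have hs := sin_pos_of_obtuse hθ
  have hcosn := cos_neg_of_obtuse hθ
  set e := Complex.exp (θ * Complex.I) with he
  have hen : ‖e‖ = 1 := Complex.norm_exp_ofReal_mul_I θ
  set D : ℂ → ℂ := fun ζ => (1 + (β - 1) / ζ - z * β * ζ ^ ((β : ℂ) - 1)) * wrightIntegrand β z ζ
  set m := c / 2 * Real.sin θ with hm
  have hm0 : 0 < m := by positivity
  set K := (1 + (1 - β) / m + z * β * m ^ (β - 1)) * (Real.exp (2 * c) * m ^ (β - 1)) with hK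
  have hDbound : ∀ a ∈ Ioo (c / 2) (2 * c), ∀ t : ℝ, 0 ≤ t →
      ‖e * D (rayPoint θ a t)‖ ≤ K * Real.exp (-(-Real.cos θ * t)) := by
    intro a ha t ht
    have h1 := norm_wrightIntegrand_le_exp hβ hβ' hθ hβθ hz (half_pos hc) ha.1.le ha.2.le ht
    have h0 : m ≤ ‖rayPoint θ a t‖ :=
      le_trans (by rw [hm]; gcongr; exact ha.1.le) mul_sin_le_norm_rayPoint'
    have h2 : ‖rayPoint θ a t‖ ^ (β - 1) ≤ m ^ (β - 1) :=
      Real.rpow_le_rpow_of_nonpos hm0 h0 (by linarith)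
    have hcos : 0 < Real.cos (β * θ) := Real.cos_pos_of_mem_Ioo
      ⟨by nlinarith [hθ.1, Real.pi_pos], hβθ⟩
    have h3 : Real.exp (-(z * (m ^ β * Real.cos (β * θ)))) ≤ 1 :=
      Real.exp_le_one_iff.2 (neg_nonpos.2 (by positivity))
    have e1 : ((β : ℂ) - 1) = ((β - 1 : ℝ) : ℂ) := by push_cast; rfl
    have h4 : ‖1 + ((β : ℂ) - 1) / rayPoint θ a t - z * β * rayPoint θ a t ^ ((β : ℂ) - 1)‖
        ≤ 1 + (1 - β) / m + z * β * m ^ (β - 1) := by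
      refine (norm_sub_le _ _).trans (add_le_add ((norm_add_le _ _).trans (add_le_add ?_ ?_)) ?_)
      · simp
      · rw [e1, norm_div, Complex.norm_real, Real.norm_eq_abs, abs_sub_comm,
          abs_of_nonneg (by linarith)]
        gcongr
      · rw [e1, norm_mul, norm_mul, Complex.norm_real, Complex.norm_real, Complex.norm_cpow_real,
          Real.norm_of_nonneg hz, Real.norm_of_nonneg hβ.le]
        gcongr
    rw [norm_mul, hen, one_mul, norm_mul]
    calc _ ≤ (1 + (1 - β) / m + z * β * m ^ (β - 1)) * (Real.exp (2 * c) * m ^ (β - 1)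
        * Real.exp (-(z * (m ^ β * Real.cos (β * θ)))) * Real.exp (-(-Real.cos θ * t))) := by
          refine mul_le_mul h4 h1 (norm_nonneg _) ((norm_nonneg _).trans h4)
      _ ≤ (1 + (1 - β) / m + z * β * m ^ (β - 1)) * (Real.exp (2 * c) * m ^ (β - 1)
        * 1 * Real.exp (-(-Real.cos θ * t))) := by
          refine mul_le_mul_of_nonneg_left ?_ ((norm_nonneg _).trans h4)
          gcongr
      _ = _ := by rw [hK]; ring
  have hcd : ∀ a t : ℝ, HasDerivAt (fun a => rayPoint θ a t) 1 a := fun a t => by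
    exact (Complex.ofRealCLM.hasDerivAt (x := a)).add_const (t * e)
  have htd : ∀ a t : ℝ, HasDerivAt (rayPoint θ a) e t := fun a t => by
    have := ((Complex.ofRealCLM.hasDerivAt (x := t)).mul_const e).const_add (a : ℂ)
    rw [Complex.ofRealCLM_apply, Complex.ofReal_one, one_mul] at this
    exact this
  have hexp : IntegrableOn (fun t => Real.exp (-(-Real.cos θ * t))) (Ioi 0) := by
    simpa using integrableOn_rpow_sub_one_mul_exp_neg one_pos (neg_pos.2 hcosn)
  have hmem : ∀ a ∈ Ioo (c / 2) (2 * c), ∀ t : ℝ, 0 ≤ t → rayPoint θ a t ∈ Complex.slitPlane :=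
    fun a ha t ht => rayPoint_mem_slitPlane hθ ht
      (Or.inl ((half_pos hc).trans ha.1))
  have hcc : c ∈ Ioo (c / 2) (2 * c) := ⟨by linarith, by linarith⟩
  have hDc : ContinuousOn (fun t => e * D (rayPoint θ c t)) (Ici 0) := by
    intro t ht
    have h := hmem c hcc t ht
    have h1 : ContinuousAt (rayPoint θ c) t := (htd c t).continuousAt
    refine (continuousAt_const.mul (ContinuousAt.mul ?_ ?_)).continuousWithinAt
    · exact (continuousAt_const.add (continuousAt_const.div h1
        (Complex.slitPlane_ne_zero h))).sub
        (continuousAt_const.mul (h1.cpow continuousAt_const h))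
    · exact ((hasDerivAt_wrightIntegrand h).continuousAt).comp h1
  obtain ⟨hint, hder⟩ := hasDerivAt_integral_of_dominated_loc_of_deriv_le
    (μ := volume.restrict (Ioi (0 : ℝ)))
    (F := fun c t => e * wrightIntegrand β z (rayPoint θ c t))
    (F' := fun c t => e * D (rayPoint θ c t))
    (bound := fun t => K * Real.exp (-(-Real.cos θ * t)))
    (Ioo_mem_nhds hcc.1 hcc.2)
    (by
      filter_upwards [Ioo_mem_nhds hcc.1 hcc.2] with a ha
      exact ((integrableOn_wrightIntegrand_ray hβ hβ' hθ hβθ hz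
        ((half_pos hc).trans ha.1).le).const_mul e).aestronglyMeasurable)
    ((integrableOn_wrightIntegrand_ray hβ hβ' hθ hβθ hz hc.le).const_mul e)
    ((hDc.mono Ioi_subset_Ici_self).aestronglyMeasurable measurableSet_Ioi)
    (by
      filter_upwards [ae_restrict_mem measurableSet_Ioi] with t ht a ha
      exact hDbound a ha t (le_of_lt ht))
    (hexp.const_mul K)
    (by
      filter_upwards [ae_restrict_mem measurableSet_Ioi] with t ht a ha
      have := (hasDerivAt_wrightIntegrand (β := β) (z := z)
        (hmem a ha t (le_of_lt ht))).comp a (hcd a t)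
      simpa using this.const_mul e)
  have hlim : Tendsto (fun t => wrightIntegrand β z (rayPoint θ c t)) atTop (𝓝 0) := by
    have hb : Tendsto (fun t : ℝ => Real.exp (2 * c) * m ^ (β - 1)
        * Real.exp (-(z * (m ^ β * Real.cos (β * θ)))) * Real.exp (-(-Real.cos θ * t)))
        atTop (𝓝 (Real.exp (2 * c) * m ^ (β - 1)
        * Real.exp (-(z * (m ^ β * Real.cos (β * θ)))) * 0)) :=
      (Real.tendsto_exp_neg_atTop_nhds_zero.comp
        (tendsto_id.const_mul_atTop (neg_pos.2 hcosn))).const_mul _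
    rw [mul_zero] at hb
    refine squeeze_zero_norm' ?_ hb
    filter_upwards [eventually_ge_atTop 0] with t ht
    exact norm_wrightIntegrand_le_exp hβ hβ' hθ hβθ hz (half_pos hc) hcc.1.le hcc.2.le ht
  have hftc := integral_Ioi_of_hasDerivAt_of_tendsto'
    (f := fun t => wrightIntegrand β z (rayPoint θ c t))
    (f' := fun t => e * D (rayPoint θ c t)) (a := 0) (fun t ht => by
      have := (hasDerivAt_wrightIntegrand (β := β) (z := z)
        (hmem c hcc t ht)).comp t (htd c t)
      rw [mul_comm] at this
      exact this) hint hlim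
  rw [hftc] at hder
  simpa [rayPoint] using hder

/-- The imaginary part of the contour integral does not depend on the starting point of the ray,
because the integrand is real on the positive real axis. -/
theorem im_integral_wrightIntegrand_ray (hz : 0 ≤ z) {c : ℝ} (hc : 0 < c) :
    (∫ t in Ioi (0 : ℝ), Complex.exp (θ * Complex.I) * wrightIntegrand β z (rayPoint θ c t)).im
      = (∫ t in Ioi (0 : ℝ), rayIntegrand β θ z t).im := by
  set G : ℝ → ℂ := fun c => ∫ t in Ioi (0 : ℝ),
        Complex.exp (θ * Complex.I) * wrightIntegrand β z (rayPoint θ c t) with hG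
  have hG0 : G 0 = ∫ t in Ioi (0 : ℝ), rayIntegrand β θ z t :=
    setIntegral_congr_fun measurableSet_Ioi fun t ht => exp_mul_wrightIntegrand_ray hθ ht
  have hcont : ContinuousOn G (Icc 0 c) := by
    refine continuousOn_of_dominated (bound := fun t => Real.exp c * Real.sin θ ^ (β - 1)
        * (t ^ (β - 1) * Real.exp (-(-Real.cos θ * t)))) ?_ ?_ ?_ ?_
    · intro a ha
      exact ((integrableOn_wrightIntegrand_ray hβ hβ' hθ hβθ hz ha.1).const_mul
        _).aestronglyMeasurable
    · intro a ha
      filter_upwards [ae_restrict_mem measurableSet_Ioi] with t ht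
      rw [norm_mul, Complex.norm_exp_ofReal_mul_I, one_mul]
      exact norm_wrightIntegrand_le_rpow hβ hβ' hθ hβθ hz ha.1 ha.2 ht
    · exact (integrableOn_rpow_sub_one_mul_exp_neg hβ
        (neg_pos.2 (cos_neg_of_obtuse hθ))).const_mul _
    · filter_upwards [ae_restrict_mem measurableSet_Ioi] with t ht a ha
      have h := rayPoint_mem_slitPlane (c := a) hθ (le_of_lt ht) (Or.inr ht)
      have h1 : ContinuousAt (fun a => rayPoint θ a t) a := by unfold rayPoint; fun_prop
      exact (continuousAt_const.mul (ContinuousAt.comp (f := fun a => rayPoint θ a t)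
        (hasDerivAt_wrightIntegrand h).continuousAt h1)).continuousWithinAt
  have hder : ∀ a ∈ Ioo 0 c, HasDerivAt (fun a => (G a).im) 0 a := by
    intro a ha
    have h1 := integral_wrightIntegrand_ray_hasDerivAt hβ hβ' hθ hβθ hz ha.1
    have h2 := Complex.imCLM.hasFDerivAt.comp_hasDerivAt a h1
    refine h2.congr_deriv ?_
    have : wrightIntegrand β z a
        = ((Real.exp a * a ^ (β - 1) * Real.exp (-(z * a ^ β)) : ℝ) : ℂ) := by
      rw [wrightIntegrand]
      push_cast
      rw [Complex.ofReal_cpow ha.1.le, Complex.ofReal_cpow ha.1.le]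
      push_cast
      rfl
    rw [Complex.imCLM_apply, this, Complex.neg_im, Complex.ofReal_im, neg_zero]
  obtain ⟨a, -, h⟩ := exists_hasDerivAt_eq_slope (fun a => (G a).im) (fun _ => 0) hc
    (Complex.continuous_im.comp_continuousOn hcont) hder
  rw [eq_comm, div_eq_zero_iff] at h
  rw [← hG0]
  change (G c).im = (G 0).im
  rcases h with h | h <;> linarith

/-- The ray representation of `M_β` with the contour kept away from the origin. -/
theorem wrightM_eq_shifted_ray (hz : 0 ≤ z) {c : ℝ} (hc : 0 < c) :
    wrightM β z = (∫ t in Ioi (0 : ℝ),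
      Complex.exp (θ * Complex.I) * wrightIntegrand β z (rayPoint θ c t)).im / Real.pi := by
  rw [im_integral_wrightIntegrand_ray hβ hβ' hθ hβθ hz hc, wrightM_eq_ray hβ hβ' hθ]

end Shift

/-! ### Decay, moments and Laplace transform of the M-Wright function -/

theorem wrightLaw_eq (β : ℝ) : wrightLaw β = (volume.restrict (Ioi (0 : ℝ))).withDensity
    (fun τ => ENNReal.ofReal (wrightM β τ)) := by
  rw [wrightLaw, restrict_Ioi_eq_restrict_Ici]

section Decay
variable {β : ℝ} (hβ : 0 < β) (hβ' : β < 1)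
include hβ hβ'

theorem exists_obtuse_angle :
    ∃ θ ∈ Ioo (Real.pi / 2) Real.pi, β * θ < Real.pi / 2 := by
  have h : Real.pi / 2 < min Real.pi (Real.pi / 2 / β) := by
    refine lt_min (by linarith [Real.pi_pos]) ?_
    rw [lt_div_iff₀ hβ]
    nlinarith [Real.pi_pos]
  obtain ⟨θ, h1, h2⟩ := exists_between h
  refine ⟨θ, ⟨h1, h2.trans_le (min_le_left _ _)⟩, ?_⟩
  have := h2.trans_le (min_le_right _ _)
  rw [lt_div_iff₀ hβ] at this
  linarith

/-- `M_β` decays faster than every exponential: start the ray at a point `c` so large that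
`(c sin θ)^β cos (β θ) ≥ r`. -/
theorem exists_abs_wrightM_le (r : ℝ) :
    ∃ K : ℝ, ∀ z, 0 ≤ z → |wrightM β z| ≤ K * Real.exp (-(r * z)) := by
  obtain ⟨θ, hθ, hβθ⟩ := exists_obtuse_angle hβ hβ'
  have hs := sin_pos_of_obtuse hθ
  have hcos : 0 < Real.cos (β * θ) := Real.cos_pos_of_mem_Ioo
    ⟨by nlinarith [hθ.1, Real.pi_pos], hβθ⟩
  have hexp : IntegrableOn (fun t => Real.exp (-(-Real.cos θ * t))) (Ioi 0) := by
    simpa using integrableOn_rpow_sub_one_mul_exp_neg one_pos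
      (neg_pos.2 (cos_neg_of_obtuse hθ))
  set m := (|r| / Real.cos (β * θ)) ^ β⁻¹ + 1 with hm
  have hm0 : 0 < m := by positivity
  have hmr : r ≤ m ^ β * Real.cos (β * θ) := by
    rw [← div_le_iff₀ hcos]
    calc r / Real.cos (β * θ) ≤ |r| / Real.cos (β * θ) := by gcongr; exact le_abs_self r
      _ = ((|r| / Real.cos (β * θ)) ^ β⁻¹) ^ β := by
        rw [Real.rpow_inv_rpow (by positivity) hβ.ne']
      _ ≤ m ^ β := by gcongr; rw [hm]; linarith
  set c := m / Real.sin θ with hc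
  have hc0 : 0 < c := by positivity
  have hcm : c * Real.sin θ = m := div_mul_cancel₀ _ hs.ne'
  refine ⟨Real.exp c * m ^ (β - 1) * (∫ t in Ioi (0 : ℝ), Real.exp (-(-Real.cos θ * t)))
    / Real.pi, fun z hz => ?_⟩
  rw [wrightM_eq_shifted_ray hβ hβ' hθ hβθ hz hc0, abs_div, abs_of_pos Real.pi_pos,
    div_mul_eq_mul_div]
  refine div_le_div_of_nonneg_right ?_ Real.pi_pos.le
  refine (Complex.abs_im_le_norm _).trans ?_
  refine (norm_integral_le_of_norm_le (hexp.const_mul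
    (Real.exp c * m ^ (β - 1) * Real.exp (-(z * (m ^ β * Real.cos (β * θ)))))) ?_).trans ?_
  · filter_upwards [ae_restrict_mem measurableSet_Ioi] with t ht
    rw [norm_mul, Complex.norm_exp_ofReal_mul_I, one_mul, ← hcm]
    exact norm_wrightIntegrand_le_exp hβ hβ' hθ hβθ hz hc0 le_rfl le_rfl (le_of_lt ht)
  · rw [integral_const_mul]
    have h1 : Real.exp (-(z * (m ^ β * Real.cos (β * θ)))) ≤ Real.exp (-(r * z)) := by
      apply Real.exp_le_exp.2
      nlinarith
    have h2 : 0 ≤ ∫ t in Ioi (0 : ℝ), Real.exp (-(-Real.cos θ * t)) :=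
      integral_nonneg fun t => (Real.exp_pos _).le
    calc _ ≤ Real.exp c * m ^ (β - 1) * Real.exp (-(r * z))
          * ∫ t in Ioi (0 : ℝ), Real.exp (-(-Real.cos θ * t)) := by gcongr
      _ = _ := by ring

theorem continuousOn_wrightM : ContinuousOn (wrightM β) (Ici 0) := by
  obtain ⟨θ, hθ, hβθ⟩ := exists_obtuse_angle hβ hβ'
  have hs := sin_pos_of_obtuse hθ
  have hcos : 0 < Real.cos (β * θ) := Real.cos_pos_of_mem_Ioo
    ⟨by nlinarith [hθ.1, Real.pi_pos], hβθ⟩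
  have hexp : IntegrableOn (fun t => Real.exp (-(-Real.cos θ * t))) (Ioi 0) := by
    simpa using integrableOn_rpow_sub_one_mul_exp_neg one_pos
      (neg_pos.2 (cos_neg_of_obtuse hθ))
  have h : ContinuousOn (fun z => (∫ t in Ioi (0 : ℝ), Complex.exp (θ * Complex.I)
      * wrightIntegrand β z (rayPoint θ 1 t)).im / Real.pi) (Ici 0) := by
    refine ContinuousOn.div_const (Complex.continuous_im.comp_continuousOn ?_) _
    refine continuousOn_of_dominated (bound := fun t => Real.exp 1
      * (1 * Real.sin θ) ^ (β - 1) * Real.exp (-(-Real.cos θ * t))) ?_ ?_ ?_ ?_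
    · intro z hz
      exact ((integrableOn_wrightIntegrand_ray hβ hβ' hθ hβθ hz zero_le_one).const_mul
        _).aestronglyMeasurable
    · intro z hz
      have hz' : 0 ≤ z := hz
      filter_upwards [ae_restrict_mem measurableSet_Ioi] with t ht
      rw [norm_mul, Complex.norm_exp_ofReal_mul_I, one_mul]
      refine (norm_wrightIntegrand_le_exp hβ hβ' hθ hβθ hz' one_pos le_rfl le_rfl
        (le_of_lt ht)).trans ?_
      refine mul_le_mul_of_nonneg_right ?_ (Real.exp_pos _).le
      refine mul_le_of_le_one_right (by positivity) (Real.exp_le_one_iff.2 (neg_nonpos.2 ?_))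
      positivity
    · exact hexp.const_mul _
    · refine ae_of_all _ fun t => Continuous.continuousOn ?_
      unfold wrightIntegrand
      fun_prop
  exact h.congr fun z hz => wrightM_eq_shifted_ray hβ hβ' hθ hβθ hz one_pos

theorem aestronglyMeasurable_wrightM :
    AEStronglyMeasurable (wrightM β) (volume.restrict (Ioi 0)) :=
  ((continuousOn_wrightM hβ hβ').mono Ioi_subset_Ici_self).aestronglyMeasurable measurableSet_Ioi

theorem integrableOn_exp_mul_wrightM (r : ℝ) :
    IntegrableOn (fun z => Real.exp (r * z) * wrightM β z) (Ioi 0) := by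
  obtain ⟨K, hK⟩ := exists_abs_wrightM_le hβ hβ' (r + 1)
  have hexp : IntegrableOn (fun t => Real.exp (-(1 * t))) (Ioi 0) := by
    simpa using integrableOn_rpow_sub_one_mul_exp_neg one_pos one_pos
  refine Integrable.mono' (hexp.const_mul K) (AEStronglyMeasurable.mul
    (by fun_prop) (aestronglyMeasurable_wrightM hβ hβ')) ?_
  filter_upwards [ae_restrict_mem measurableSet_Ioi] with z hz
  rw [norm_mul, Real.norm_of_nonneg (Real.exp_pos _).le, Real.norm_eq_abs]
  calc _ ≤ Real.exp (r * z) * (K * Real.exp (-((r + 1) * z))) := by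
        gcongr; exact hK z (le_of_lt hz)
    _ = K * (Real.exp (r * z) * Real.exp (-((r + 1) * z))) := by ring
    _ = _ := by rw [← Real.exp_add]; ring_nf

theorem integrableOn_wrightM : IntegrableOn (wrightM β) (Ioi 0) := by
  simpa using integrableOn_exp_mul_wrightM hβ hβ' 0

/-- The Mellin transform of `M_β` on `(0, 1)`, where Fubini applies to the ray from the origin. -/
theorem integral_rpow_mul_wrightM {s : ℝ} (hs : s ∈ Ioo 0 1) :
    ∫ z in Ioi (0 : ℝ), z ^ (s - 1) * wrightM β z
      = Real.Gamma s / Real.Gamma (1 - β + β * s) := by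
  obtain ⟨θ, hθ, hβθ⟩ := exists_obtuse_angle hβ hβ'
  have hcosn := cos_neg_of_obtuse hθ
  have hcos : 0 < Real.cos (β * θ) := Real.cos_pos_of_mem_Ioo
    ⟨by nlinarith [hθ.1, Real.pi_pos], hβθ⟩
  have hb : 0 < β * (1 - s) := mul_pos hβ (by linarith [hs.2])
  set f : ℝ → ℝ → ℂ := fun z t => ((z ^ (s - 1) : ℝ) : ℂ) * rayIntegrand β θ z t with hf
  have hmeas : Measurable (Function.uncurry f) := by
    simp only [hf, Function.uncurry_def, rayIntegrand]; fun_prop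
  have hnorm : ∀ t, 0 < t → ∀ z, 0 < z → ‖f z t‖ = t ^ (β - 1) * Real.exp (-(-Real.cos θ * t))
      * (z ^ (s - 1) * Real.exp (-((t ^ β * Real.cos (β * θ)) * z))) := by
    intro t ht z hz
    have e : (β * θ * Complex.I + t * Complex.exp (θ * Complex.I)
        - z * ((t ^ β : ℝ) : ℂ) * Complex.exp (β * θ * Complex.I)).re
        = -(-Real.cos θ * t) + -((t ^ β * Real.cos (β * θ)) * z) := by
      rw [Complex.sub_re, Complex.add_re, ← Complex.ofReal_mul, ← Complex.ofReal_mul,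
        Complex.re_ofReal_mul, Complex.re_ofReal_mul, Complex.re_ofReal_mul,
        Complex.exp_ofReal_mul_I_re, Complex.exp_ofReal_mul_I_re, Complex.I_re]
      ring
    simp only [hf, rayIntegrand, norm_mul, Complex.norm_real, Complex.norm_exp, e, Real.exp_add]
    rw [Real.norm_of_nonneg (by positivity), Real.norm_of_nonneg (by positivity)]
    ring
  have hint : Integrable (Function.uncurry f)
      ((volume.restrict (Ioi (0 : ℝ))).prod (volume.restrict (Ioi (0 : ℝ)))) := by
    rw [integrable_prod_iff' hmeas.aestronglyMeasurable]
    refine ⟨?_, ?_⟩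
    · filter_upwards [ae_restrict_mem measurableSet_Ioi] with t ht
      have ht' : (0 : ℝ) < t := ht
      have h1 := (integrableOn_rpow_sub_one_mul_exp_neg hs.1
        (mul_pos (Real.rpow_pos_of_pos ht' β) hcos)).const_mul
        (t ^ (β - 1) * Real.exp (-(-Real.cos θ * t)))
      refine Integrable.mono' h1 (hmeas.comp measurable_prodMk_right).aestronglyMeasurable ?_
      filter_upwards [ae_restrict_mem measurableSet_Ioi] with z hz using (hnorm t ht z hz).le
    · have h1 := ((integrableOn_rpow_sub_one_mul_exp_neg hb (neg_pos.2 hcosn)).mul_const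
        (Real.cos (β * θ) ^ (-s) * Real.Gamma s))
      refine IntegrableOn.congr_fun h1 (fun t ht => ?_) measurableSet_Ioi
      have ht' : (0 : ℝ) < t := ht
      have h2 : ∫ z in Ioi (0 : ℝ), ‖f z t‖ = ∫ z in Ioi (0 : ℝ),
          t ^ (β - 1) * Real.exp (-(-Real.cos θ * t))
          * (z ^ (s - 1) * Real.exp (-((t ^ β * Real.cos (β * θ)) * z))) :=
        setIntegral_congr_fun measurableSet_Ioi fun z hz => hnorm t ht z hz
      have h3 : t ^ (β * (1 - s) - 1) = t ^ (β - 1) * t ^ (β * (-s)) := by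
        rw [← Real.rpow_add ht']; ring_nf
      simp only [Function.uncurry_apply_pair]
      rw [h2, integral_const_mul, Real.integral_rpow_mul_exp_neg_mul_Ioi hs.1 (by positivity),
        one_div, Real.inv_rpow (by positivity), ← Real.rpow_neg (by positivity),
        Real.mul_rpow (by positivity) hcos.le, ← Real.rpow_mul ht'.le, h3]
      ring
  have hinner : ∀ t, 0 < t → ∫ z in Ioi (0 : ℝ), f z t
      = (Real.Gamma s : ℂ) * (((t ^ (β * (1 - s) - 1) : ℝ) : ℂ)
        * Complex.exp ((β * (1 - s) : ℝ) * θ * Complex.I + t * Complex.exp (θ * Complex.I))) := by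
    intro t ht
    set w : ℂ := ((t ^ β : ℝ) : ℂ) * Complex.exp (β * θ * Complex.I) with hw
    have hwre : 0 < w.re := by
      rw [hw, Complex.re_ofReal_mul, ← Complex.ofReal_mul, Complex.exp_ofReal_mul_I_re]
      positivity
    have hlog : Complex.log w = β * Real.log t + β * θ * Complex.I := by
      have hi : (β * θ * Complex.I : ℂ).im = β * θ := by
        rw [← Complex.ofReal_mul, Complex.im_ofReal_mul, Complex.I_im, mul_one]
      have : -Real.pi < β * θ := by nlinarith [hθ.1, Real.pi_pos]
      rw [hw, Complex.log_ofReal_mul (by positivity) (Complex.exp_ne_zero _), Real.log_rpow ht,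
        Complex.log_exp (by rw [hi]; exact this) (by rw [hi]; linarith [Real.pi_pos])]
      push_cast
      rfl
    have h1 : ∀ z : ℝ, f z t = ((t ^ (β - 1) : ℝ) : ℂ) * Complex.exp (β * θ * Complex.I
        + t * Complex.exp (θ * Complex.I))
        * (((z ^ (s - 1) : ℝ) : ℂ) * Complex.exp (-(w * z))) := by
      intro z
      simp only [hf, rayIntegrand, hw, sub_eq_add_neg _ ((z : ℂ) * _ * _), Complex.exp_add]
      ring_nf
    simp_rw [h1]
    rw [integral_const_mul, integral_rpow_mul_cexp_neg_mul_Ioi hs.1 hwre,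
      Complex.cpow_def_of_ne_zero (by intro h0; simp [h0] at hwre), hlog, Real.rpow_def_of_pos ht,
      Real.rpow_def_of_pos ht, mul_left_comm]
    push_cast
    rw [← Complex.exp_add, ← Complex.exp_add, ← Complex.exp_add]
    congr 2
    ring
  have hswap := integral_integral_swap hint
  have hL : (∫ z in Ioi (0 : ℝ), ∫ t in Ioi (0 : ℝ), f z t).im / Real.pi
      = ∫ z in Ioi (0 : ℝ), z ^ (s - 1) * wrightM β z := by
    have h1 := hint.integral_prod_left
    have h2 := Complex.imCLM.integral_comp_comm h1
    simp only [Complex.imCLM_apply] at h2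
    simp only [Function.uncurry_apply_pair] at h2
    rw [← h2, ← integral_div]
    refine setIntegral_congr_fun measurableSet_Ioi fun z hz => ?_
    simp only [hf]
    rw [integral_const_mul, Complex.im_ofReal_mul, wrightM_eq_ray hβ hβ' hθ]
    ring
  have hR : ∫ t in Ioi (0 : ℝ), ∫ z in Ioi (0 : ℝ), f z t = Real.Gamma s
      * (Real.Gamma (β * (1 - s)) * Complex.exp (Real.pi * (β * (1 - s) : ℝ) * Complex.I)) := by
    rw [← integral_rpow_mul_cexp_ray hb hθ, ← integral_const_mul]
    exact setIntegral_congr_fun measurableSet_Ioi fun t ht => hinner t ht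
  have hG : Real.Gamma (1 - β + β * s) = Real.Gamma (1 - β * (1 - s)) := by ring_nf
  rw [← hL, hswap, hR, hG, div_eq_mul_inv (Real.Gamma s), inv_Gamma_one_sub hb,
    Complex.im_ofReal_mul, Complex.im_ofReal_mul, ← Complex.ofReal_mul,
    Complex.exp_ofReal_mul_I_im]
  ring

/-- The Mellin transform of `M_β` on the right half-plane, continued analytically from
`(0, 1)`. -/
theorem mellin_wrightM {s : ℂ} (hs : 0 < s.re) :
    mellin (fun z => (wrightM β z : ℂ)) s
      = Complex.Gamma s * (Complex.Gamma (1 - β + β * s))⁻¹ := by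
  have hU : IsOpen {z : ℂ | 0 < z.re} := isOpen_lt continuous_const Complex.continuous_re
  have hloc : LocallyIntegrableOn (fun z => (wrightM β z : ℂ)) (Ioi 0) :=
    IntegrableOn.locallyIntegrableOn ((integrableOn_wrightM hβ hβ').ofReal (𝕜 := ℂ))
  obtain ⟨K, hK⟩ := exists_abs_wrightM_le hβ hβ' 1
  have htop : (fun z => (wrightM β z : ℂ)) =O[atTop] fun t => Real.exp (-1 * t) := by
    refine Asymptotics.IsBigO.of_bound K ?_
    filter_upwards [eventually_ge_atTop 0] with z hz
    rw [Complex.norm_real, Real.norm_eq_abs, Real.norm_of_nonneg (Real.exp_pos _).le]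
    simpa using hK z hz
  have hbot : (fun z => (wrightM β z : ℂ)) =O[𝓝[>] 0] (· ^ (-(0 : ℝ))) := by
    refine Asymptotics.IsBigO.of_bound |K| ?_
    filter_upwards [self_mem_nhdsWithin] with z hz
    have hz' : (0 : ℝ) < z := hz
    rw [Complex.norm_real, Real.norm_eq_abs, neg_zero, Real.rpow_zero, norm_one, mul_one]
    refine (hK z hz'.le).trans ((mul_le_mul_of_nonneg_right (le_abs_self K)
      (Real.exp_pos _).le).trans (mul_le_of_le_one_right (abs_nonneg K) ?_))
    exact Real.exp_le_one_iff.2 (by linarith)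
  have h1 : AnalyticOnNhd ℂ (mellin (fun z => (wrightM β z : ℂ))) {z | 0 < z.re} :=
    DifferentiableOn.analyticOnNhd (fun z hz =>
      (mellin_differentiableAt_of_isBigO_rpow_exp one_pos hloc htop hbot
        hz).differentiableWithinAt) hU
  have h2 : AnalyticOnNhd ℂ (fun s : ℂ => Complex.Gamma s * (Complex.Gamma (1 - β + β * s))⁻¹)
      {z | 0 < z.re} := by
    refine DifferentiableOn.analyticOnNhd (fun z hz => ?_) hU
    have hz' : 0 < z.re := hz
    refine DifferentiableAt.differentiableWithinAt (DifferentiableAt.mul ?_ ?_)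
    · refine Complex.differentiableAt_Gamma z fun m h => ?_
      rw [h] at hz'
      simp at hz'
      linarith [(Nat.cast_nonneg m : (0 : ℝ) ≤ m)]
    · exact DifferentiableAt.comp (g := fun s => (Complex.Gamma s)⁻¹) z
        (Complex.differentiable_one_div_Gamma _) (by fun_prop)
  refine h1.eqOn_of_preconnected_of_frequently_eq h2
      (convex_halfSpace_re_gt 0).isPreconnected (z₀ := ((1 / 2 : ℝ) : ℂ)) (by simp) ?_ hs
  have hreal : ∀ x : ℝ, x ∈ Ioo 0 1 → mellin (fun z => (wrightM β z : ℂ)) x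
      = Complex.Gamma x * (Complex.Gamma (1 - β + β * x))⁻¹ := by
    intro x hx
    have e : (1 - β + β * x : ℂ) = ((1 - β + β * x : ℝ) : ℂ) := by push_cast; rfl
    rw [e, Complex.Gamma_ofReal, Complex.Gamma_ofReal, ← Complex.ofReal_inv, ← Complex.ofReal_mul,
      ← div_eq_mul_inv, ← integral_rpow_mul_wrightM hβ hβ' hx, mellin, ← integral_complex_ofReal]
    refine setIntegral_congr_fun measurableSet_Ioi fun t ht => ?_
    have ht' : (0 : ℝ) < t := ht
    simp only [smul_eq_mul]
    push_cast
    rw [Complex.ofReal_cpow ht'.le]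
    push_cast
    rfl
  have hx : Tendsto (fun n : ℕ => ((1 / 2 : ℝ) - 1 / ((n : ℝ) + 3))) atTop (𝓝 (1 / 2)) := by
    have : Tendsto (fun n : ℕ => 1 / ((n : ℝ) + 3)) atTop (𝓝 0) :=
      tendsto_const_nhds.div_atTop (tendsto_atTop_add_const_right _ _ tendsto_natCast_atTop_atTop)
    simpa using tendsto_const_nhds.sub this
  rw [frequently_iff_seq_forall]
  have hn : ∀ n : ℕ, 0 < 1 / ((n : ℝ) + 3) ∧ 1 / ((n : ℝ) + 3) < 1 / 2 := fun n => by
    refine ⟨by positivity, one_div_lt_one_div_of_lt (by norm_num) ?_⟩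
    linarith [(Nat.cast_nonneg n : (0 : ℝ) ≤ n)]
  refine ⟨fun n : ℕ => (((1 / 2 : ℝ) - 1 / ((n : ℝ) + 3) : ℝ) : ℂ), ?_, fun n => hreal _ ?_⟩
  · rw [tendsto_nhdsWithin_iff]
    refine ⟨(Complex.continuous_ofReal.tendsto _).comp hx, Eventually.of_forall fun n => ?_⟩
    simp only [mem_compl_iff, mem_singleton_iff, Complex.ofReal_inj]
    linarith [(hn n).1]
  · constructor <;> linarith [(hn n).1, (hn n).2]

theorem integral_pow_mul_wrightM (n : ℕ) :
    ∫ z in Ioi (0 : ℝ), z ^ n * wrightM β z = n.factorial / Real.Gamma (β * n + 1) := by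
  have h := mellin_wrightM hβ hβ' (s := ((n + 1 : ℝ) : ℂ)) (by
    rw [Complex.ofReal_re]; positivity)
  have e : (1 - β + β * ((n + 1 : ℝ) : ℂ) : ℂ) = ((β * n + 1 : ℝ) : ℂ) := by push_cast; ring
  rw [e, Complex.Gamma_ofReal, Complex.Gamma_ofReal, Real.Gamma_nat_eq_factorial,
    ← Complex.ofReal_inv, ← Complex.ofReal_mul, ← div_eq_mul_inv, mellin] at h
  rw [← Complex.ofReal_inj, ← h, ← integral_complex_ofReal]
  refine setIntegral_congr_fun measurableSet_Ioi fun t ht => ?_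
  simp

/-- The Laplace transform of `M_β` is `s ↦ E_β(-s)`. -/
theorem mittagLeffler_eq_integral (s : ℝ) :
    mittagLeffler β ((-s : ℝ) : ℂ)
      = ((∫ z in Ioi (0 : ℝ), Real.exp (-(s * z)) * wrightM β z : ℝ) : ℂ) := by
  have hexp : ∀ x : ℝ, HasSum (fun n : ℕ => x ^ n / n.factorial) (Real.exp x) := fun x => by
    rw [Real.exp_eq_exp_ℝ]; exact NormedSpace.expSeries_div_hasSum_exp _
  have hsum : HasSum (fun n : ℕ => ∫ z in Ioi (0 : ℝ), (-(s * z)) ^ n / n.factorial * wrightM β z)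
      (∫ z in Ioi (0 : ℝ), Real.exp (-(s * z)) * wrightM β z) := by
    refine hasSum_integral_of_dominated_convergence
      (fun n z => (|s| * z) ^ n / n.factorial * |wrightM β z|) (fun n => ?_) (fun n => ?_)
      ?_ ?_ ?_
    · exact AEStronglyMeasurable.mul (by fun_prop) (aestronglyMeasurable_wrightM hβ hβ')
    · filter_upwards [ae_restrict_mem measurableSet_Ioi] with z hz
      have hz' : (0 : ℝ) < z := hz
      rw [norm_mul, norm_div, norm_pow, norm_neg, norm_mul, Real.norm_eq_abs, Real.norm_eq_abs,
        Real.norm_eq_abs, Real.norm_eq_abs, abs_of_pos hz', Nat.abs_cast]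
    · exact ae_of_all _ fun z => (hexp _).summable.mul_right _
    · refine IntegrableOn.congr_fun (integrableOn_exp_mul_wrightM hβ hβ' |s|).norm
        (fun z hz => ?_) measurableSet_Ioi
      simp only [tsum_mul_right, (hexp _).tsum_eq, norm_mul, Real.norm_eq_abs, Real.abs_exp]
    · exact ae_of_all _ fun z => (hexp _).mul_right _
  have hterm : ∀ n : ℕ, ∫ z in Ioi (0 : ℝ), (-(s * z)) ^ n / n.factorial * wrightM β z
      = (-s) ^ n / Real.Gamma (β * n + 1) := by
    intro n
    have : ∀ z : ℝ, (-(s * z)) ^ n / n.factorial * wrightM β z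
        = (-s) ^ n / n.factorial * (z ^ n * wrightM β z) := fun z => by
      rw [← neg_mul, mul_pow]; ring
    simp_rw [this]
    rw [integral_const_mul, integral_pow_mul_wrightM hβ hβ']
    have : (n.factorial : ℝ) ≠ 0 := by positivity
    field_simp
  simp only [hterm] at hsum
  rw [← hsum.tsum_eq, Complex.ofReal_tsum, mittagLeffler]
  refine tsum_congr fun n => ?_
  push_cast
  rw [← Complex.Gamma_ofReal]
  push_cast
  rfl

theorem integral_wrightM : ∫ z in Ioi (0 : ℝ), wrightM β z = 1 := by
  simpa using integral_pow_mul_wrightM hβ hβ' 0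

/-- If the positive part of `M_β` is a probability density, then `M_β` is nonnegative: since
`∫ M_β = 1`, its negative part has integral `0`, and `M_β` is continuous. -/
theorem wrightM_nonneg [IsProbabilityMeasure (wrightLaw β)] {z : ℝ} (hz : 0 < z) :
    0 ≤ wrightM β z := by
  have hint := integrableOn_wrightM hβ hβ'
  have h1 : ∫⁻ z in Ioi (0 : ℝ), ENNReal.ofReal (wrightM β z) = 1 := by
    have := measure_univ (μ := wrightLaw β)
    rwa [wrightLaw_eq β, withDensity_apply _ MeasurableSet.univ,
      Measure.restrict_univ] at this
  have h2 := integral_eq_lintegral_pos_part_sub_lintegral_neg_part hint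
  rw [h1, integral_wrightM hβ hβ', ENNReal.toReal_one] at h2
  have hfin : ∫⁻ z in Ioi (0 : ℝ), ENNReal.ofReal (-wrightM β z) ≠ ∞ :=
    (hint.neg.lintegral_lt_top).ne
  have h3 : ∫⁻ z in Ioi (0 : ℝ), ENNReal.ofReal (-wrightM β z) = 0 := by
    rcases (ENNReal.toReal_eq_zero_iff _).1 (by linarith) with h | h
    · exact h
    · exact absurd h hfin
  rw [lintegral_eq_zero_iff' (f := fun z => ENNReal.ofReal (-wrightM β z))
    hint.neg.aestronglyMeasurable.aemeasurable.ennreal_ofReal] at h3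
  have habs : wrightM β =ᵐ[volume.restrict (Ioi 0)] fun z => |wrightM β z| := by
    filter_upwards [h3] with z hz
    exact (abs_of_nonneg (by simpa using hz)).symm
  have hc := (continuousOn_wrightM hβ hβ').mono Ioi_subset_Ici_self
  rw [Measure.eqOn_open_of_ae_eq habs isOpen_Ioi hc hc.abs hz]
  exact abs_nonneg _

theorem integral_wrightLaw [IsProbabilityMeasure (wrightLaw β)] (f : ℝ → ℝ) :
    ∫ τ, f τ ∂(wrightLaw β) = ∫ τ in Ioi (0 : ℝ), f τ * wrightM β τ := by
  rw [wrightLaw_eq β, integral_withDensity_eq_integral_toReal_smul₀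
    (aestronglyMeasurable_wrightM hβ hβ').aemeasurable.ennreal_ofReal
    (ae_of_all _ fun t => ENNReal.ofReal_lt_top)]
  refine integral_congr_ae ?_
  filter_upwards [ae_restrict_mem measurableSet_Ioi] with z hz
  rw [ENNReal.toReal_ofReal (wrightM_nonneg hβ hβ' hz), smul_eq_mul, mul_comm]

end Decay

/-! ### The process `Q` along a path -/

section Pathwise
variable {E : Type*} [NormedAddCommGroup E] [NormedSpace ℝ E]

/-- Riemann sums of `∫ h f` in which only `f` is frozen, at a point `τ N j` of the `j`-th of the `N`
equal parts of `[0, t]`. -/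
theorem tendsto_sum_integral_tagged {t : ℝ} (ht : 0 ≤ t) {h : ℝ → ℝ} {f : ℝ → E}
    (hh : Continuous h) (hf : Continuous f) (τ : ℕ → ℕ → ℝ)
    (hτ : ∀ N j, j < N → τ N j ∈ Icc (t * (j : ℕ) / N) (t * (j + 1 : ℕ) / N)) :
    Tendsto (fun N : ℕ => ∑ j ∈ Finset.range N,
        ∫ s in (t * (j : ℕ) / N)..(t * (j + 1 : ℕ) / N), h s • f (τ N j)) atTop
      (𝓝 (∫ s in (0 : ℝ)..t, h s • f s)) := by
  obtain ⟨C, hC⟩ := (isCompact_Icc (a := (0 : ℝ)) (b := t)).exists_bound_of_continuousOn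
    hh.continuousOn
  have hC0 : 0 ≤ C := (norm_nonneg _).trans (hC 0 ⟨le_rfl, ht⟩)
  have huc := (isCompact_Icc (a := (0 : ℝ)) (b := t)).uniformContinuousOn_of_continuous
    hf.continuousOn
  rw [Metric.uniformContinuousOn_iff] at huc
  rw [Metric.tendsto_atTop]
  intro ε hε
  have hε' : 0 < ε / (C * t + 1) := by positivity
  obtain ⟨δ, hδ, hfδ⟩ := huc _ hε'
  have hlim : Tendsto (fun N : ℕ => t / (N : ℝ)) atTop (𝓝 0) :=
    tendsto_const_nhds.div_atTop tendsto_natCast_atTop_atTop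
  obtain ⟨N₀, hN₀⟩ := eventually_atTop.1 ((hlim.eventually_lt_const hδ).and
    (eventually_ge_atTop 1))
  refine ⟨N₀, fun N hN => ?_⟩
  obtain ⟨hNδ, hN1⟩ := hN₀ N hN
  have hNpos : (0 : ℝ) < N := by exact_mod_cast hN1
  have hmesh : ∀ j : ℕ, t * (j + 1 : ℕ) / N - t * (j : ℕ) / N = t / N := fun j => by
    push_cast; ring
  have hle : ∀ j : ℕ, t * (j : ℕ) / N ≤ t * (j + 1 : ℕ) / N := fun j => by
    have : 0 ≤ t / N := by positivity
    linarith [hmesh j]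
  have hsub : ∀ j < N, Icc (t * (j : ℕ) / N) (t * (j + 1 : ℕ) / N) ⊆ Icc 0 t := by
    intro j hj
    refine Icc_subset_Icc (by positivity) ?_
    rw [div_le_iff₀ hNpos]
    have : ((j + 1 : ℕ) : ℝ) ≤ N := by exact_mod_cast hj
    gcongr
  have hint : ∀ a b, IntervalIntegrable (fun s => h s • f s) volume a b := fun a b =>
    (hh.smul hf).intervalIntegrable a b
  have htot : ∫ s in (0 : ℝ)..t, h s • f s = ∑ j ∈ Finset.range N,
      ∫ s in (t * (j : ℕ) / N)..(t * (j + 1 : ℕ) / N), h s • f s := by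
    rw [intervalIntegral.sum_integral_adjacent_intervals (a := fun j : ℕ => t * (j : ℝ) / N)
      (fun k _ => hint _ _)]
    simp [hNpos.ne']
  rw [htot, dist_eq_norm, ← Finset.sum_sub_distrib]
  have hterm : ∀ j ∈ Finset.range N,
      ‖(∫ s in (t * (j : ℕ) / N)..(t * (j + 1 : ℕ) / N), h s • f (τ N j))
        - ∫ s in (t * (j : ℕ) / N)..(t * (j + 1 : ℕ) / N), h s • f s‖
      ≤ C * (ε / (C * t + 1)) * (t / N) := by
    intro j hj
    have hj' := Finset.mem_range.1 hj
    rw [← intervalIntegral.integral_sub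
      (f := fun s => h s • f (τ N j)) ((hh.smul continuous_const).intervalIntegrable _ _)
      (hint _ _)]
    refine (intervalIntegral.norm_integral_le_of_norm_le_const
      (C := C * (ε / (C * t + 1))) fun s hs => ?_).trans (le_of_eq ?_)
    · rw [uIoc_of_le (hle j)] at hs
      have hs' := Ioc_subset_Icc_self hs
      have hτj := hτ N j hj'
      rw [← smul_sub, norm_smul]
      refine mul_le_mul (hC s (hsub j hj' hs')) ?_ (norm_nonneg _) hC0
      rw [← dist_eq_norm]
      refine (hfδ _ (hsub j hj' hτj) _ (hsub j hj' hs') ?_).le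
      rw [Real.dist_eq, abs_lt]
      constructor <;> linarith [hmesh j, hτj.1, hτj.2, hs'.1, hs'.2]
    · rw [hmesh, abs_of_nonneg (by positivity)]
  refine (norm_sum_le_of_le _ hterm).trans_lt ?_
  rw [Finset.sum_const, Finset.card_range, nsmul_eq_mul]
  have : (N : ℝ) * (C * (ε / (C * t + 1)) * (t / N)) = ε * (C * t / (C * t + 1)) := by
    field_simp
  rw [this]
  have h1 : C * t / (C * t + 1) < 1 := by
    rw [div_lt_one (by positivity)]; linarith
  calc _ < ε * 1 := by gcongr
    _ = ε := mul_one ε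

/-- The smooth function `s ↦ (t - s) e^{-x(t - s)}`, which agrees with `gKernel x t` on `[0, t)`. -/
noncomputable def gSmooth (x t s : ℝ) : ℝ := (t - s) * Real.exp (-x * (t - s))

/-- Minus the derivative of `gSmooth x t`. -/
noncomputable def gSlope (x t s : ℝ) : ℝ := (1 - x * (t - s)) * Real.exp (-x * (t - s))

theorem continuous_gSmooth (x t : ℝ) : Continuous (gSmooth x t) := by unfold gSmooth; fun_prop

theorem continuous_gSlope (x t : ℝ) : Continuous (gSlope x t) := by unfold gSlope; fun_prop

theorem hasDerivAt_exp_neg_mul_sub (x t s : ℝ) :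
    HasDerivAt (fun s => Real.exp (-x * (t - s))) (x * Real.exp (-x * (t - s))) s := by
  have h := (((hasDerivAt_id s).const_sub t).const_mul (-x)).exp
  refine h.congr_deriv ?_
  simp only [id]; ring

theorem hasDerivAt_gSmooth (x t s : ℝ) : HasDerivAt (gSmooth x t) (-gSlope x t s) s := by
  have h := ((hasDerivAt_id s).const_sub t).mul (hasDerivAt_exp_neg_mul_sub x t s)
  refine h.congr_deriv ?_
  simp only [id, gSlope]; ring

/-- Variation of constants, for a single path: the solution `Q` of the two linear equations driven
by `w` is `∫₀ᵗ gSlope x t s • w s ds`. -/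
theorem eq_integral_gSlope_smul [CompleteSpace E] {x : ℝ} {w X Q : ℝ≥0 → E}
    (hXc : Continuous X) (hQc : Continuous Q)
    (hX : ∀ t : ℝ≥0, X t = (∫ s in (0 : ℝ)..t, (-x) • X s.toNNReal) + w t)
    (hQ : ∀ t : ℝ≥0, Q t = ∫ s in (0 : ℝ)..t, ((-x) • Q s.toNNReal + X s.toNNReal)) (t : ℝ≥0) :
    Continuous w ∧ Q t = ∫ s in (0 : ℝ)..t, gSlope x t s • w s.toNNReal := by
  have hXr : Continuous (fun s : ℝ => (-x) • X s.toNNReal) := by fun_prop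
  have hQr : Continuous (fun s : ℝ => (-x) • Q s.toNNReal + X s.toNNReal) := by fun_prop
  set V : ℝ → E := fun r => ∫ s in (0 : ℝ)..r, (-x) • X s.toNNReal with hV
  set U : ℝ → E := fun r => ∫ s in (0 : ℝ)..r, ((-x) • Q s.toNNReal + X s.toNNReal) with hU
  have hVd : ∀ s, HasDerivAt V ((-x) • X s.toNNReal) s := fun s =>
    hXr.integral_hasStrictDerivAt 0 s |>.hasDerivAt
  have hUd : ∀ s, HasDerivAt U ((-x) • Q s.toNNReal + X s.toNNReal) s :=
    fun s => hQr.integral_hasStrictDerivAt 0 s |>.hasDerivAt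
  have hVc : Continuous V := continuous_iff_continuousAt.2 fun s => (hVd s).continuousAt
  have hw : ∀ s : ℝ≥0, w s = X s - V s := fun s => by rw [hX s, add_sub_cancel_left]
  have hwc : Continuous w := by
    have : w = fun s : ℝ≥0 => X s - V s := funext hw
    rw [this]; fun_prop
  refine ⟨hwc, ?_⟩
  -- With `V = X - w`, this primitive vanishes at `0` and equals `Q t` at `t`.
  have hder : ∀ s ∈ uIcc (0 : ℝ) t, HasDerivAt
      (fun s => Real.exp (-x * (t - s)) • U s + gSmooth x t s • V s)
      (gSlope x t s • w s.toNNReal) s := by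
    intro s hs
    rw [uIcc_of_le t.coe_nonneg] at hs
    have hs0 : ((s.toNNReal : ℝ≥0) : ℝ) = s := Real.coe_toNNReal s hs.1
    have h1 := (((hasDerivAt_exp_neg_mul_sub x t s).smul (hUd s)).add
      ((hasDerivAt_gSmooth x t s).smul (hVd s)))
    refine h1.congr_deriv ?_
    have e1 : Q s.toNNReal = U s := by rw [hQ, hs0]
    have e2 : w s.toNNReal = X s.toNNReal - V s := by rw [hw, hs0]
    rw [e2, e1, gSlope, gSmooth]
    module
  rw [intervalIntegral.integral_eq_sub_of_hasDerivAt hder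
    (((continuous_gSlope x t).smul (by fun_prop)).intervalIntegrable _ _)]
  simp [hU, hV, gSmooth, hQ t]

/-- The left-point sum of `N` terms for the Wiener integral `∫₀ᵗ g dw`, `g = gSmooth x t`. -/
noncomputable def stochSum (x : ℝ) (t : ℝ≥0) (w : ℝ≥0 → E) (N : ℕ) : E :=
  ∑ j ∈ Finset.range N,
    gSmooth x t (t * (j : ℕ) / N) • (w (t * (j + 1 : ℕ) / N) - w (t * (j : ℕ) / N))

/-- Along a continuous path the left-point sums converge, since the integrand is smooth: Abel
summation moves the differences from `w` to `gSmooth x t`, which vanishes at `t`. -/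
theorem tendsto_stochSum [CompleteSpace E] {x : ℝ} {w : ℝ≥0 → E} (hw : Continuous w)
    (hw0 : w 0 = 0) (t : ℝ≥0) :
    Tendsto (stochSum x t w) atTop (𝓝 (∫ s in (0 : ℝ)..t, gSlope x t s • w s.toNNReal)) := by
  have h := tendsto_sum_integral_tagged (f := fun s => w s.toNNReal) t.coe_nonneg
    (continuous_gSlope x t)
    (by fun_prop) (fun N j => t * (j + 1 : ℕ) / N) (fun N j hj => ⟨by gcongr; simp, le_rfl⟩)
  refine h.congr' ?_
  filter_upwards [eventually_ge_atTop 1] with N hN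
  have hN0 : (N : ℝ≥0) ≠ 0 := by positivity
  set p : ℕ → ℝ≥0 := fun j => t * (j : ℕ) / N with hp
  have habel : ∀ n : ℕ, ∑ j ∈ Finset.range n, gSmooth x t (p j) • (w (p (j + 1)) - w (p j))
      = gSmooth x t (p n) • w (p n) - gSmooth x t (p 0) • w (p 0)
        + ∑ j ∈ Finset.range n,
          (gSmooth x t (p j) - gSmooth x t (p (j + 1))) • w (p (j + 1)) := by
    intro n
    induction n with
    | zero => simp
    | succ n ih => rw [Finset.sum_range_succ, Finset.sum_range_succ, ih]; module
  have hpc : ∀ j, ((p j : ℝ≥0) : ℝ) = t * (j : ℕ) / N := fun j => by simp [hp]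
  have hN1 : gSmooth x t (p N) = 0 := by
    rw [hpc, mul_div_assoc, div_self (by exact_mod_cast hN0)]; simp [gSmooth]
  have h0 : w (p 0) = 0 := by simpa [hp] using hw0
  have hs : stochSum x t w N
      = ∑ j ∈ Finset.range N, gSmooth x t (p j) • (w (p (j + 1)) - w (p j)) := by
    simp only [stochSum, hp]
    push_cast
    rfl
  rw [hs, habel, hN1, h0, zero_smul, smul_zero, sub_zero, zero_add]
  refine Finset.sum_congr rfl fun j _ => ?_
  have e : (t * (j + 1 : ℕ) / N : ℝ).toNNReal = p (j + 1) := by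
    rw [← hpc, Real.toNNReal_coe]
  rw [e, intervalIntegral.integral_smul_const, hpc, hpc]
  congr 1
  have := intervalIntegral.integral_eq_sub_of_hasDerivAt (a := (t * (j : ℕ) / N : ℝ))
    (b := (t * (j + 1 : ℕ) / N : ℝ)) (fun s _ => hasDerivAt_gSmooth x t s)
    ((continuous_gSlope x t).neg.intervalIntegrable _ _)
  rw [intervalIntegral.integral_neg] at this
  rw [← neg_sub, ← this, neg_neg]

theorem tendsto_sum_gSmooth_sq (x : ℝ) (t : ℝ≥0) :
    Tendsto (fun N : ℕ => ∑ j ∈ Finset.range N, gSmooth x t (t * (j : ℕ) / N) ^ 2 * (t / N)) atTop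
      (𝓝 (∫ s in (0 : ℝ)..t, gSmooth x t s ^ 2)) := by
  have h := tendsto_sum_integral_tagged (h := fun _ => 1) (f := fun s => gSmooth x t s ^ 2)
    t.coe_nonneg
    continuous_const ((continuous_gSmooth x t).pow 2) (fun N j => t * (j : ℕ) / N)
    (fun N j hj => ⟨le_rfl, by gcongr; simp⟩)
  simp only [one_smul] at h
  refine h.congr fun N => Finset.sum_congr rfl fun j _ => ?_
  rw [intervalIntegral.integral_const, smul_eq_mul]
  push_cast
  ring

theorem l2Norm_gKernel_sq (x : ℝ) (t : ℝ≥0) :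
    l2Norm (gKernel x t) ^ 2 = ∫ s in (0 : ℝ)..t, gSmooth x t s ^ 2 := by
  have hK : gKernel x t = (Ico (0 : ℝ) t).indicator (gSmooth x t) := rfl
  have hmem : MemLp (gKernel x t) 2 volume := by
    rw [hK, memLp_indicator_iff_restrict measurableSet_Ico]
    have h1 : MemLp (gSmooth x t) 2 (volume.restrict (Icc (0 : ℝ) t)) := by
      obtain ⟨C, hC⟩ := (isCompact_Icc (a := (0 : ℝ)) (b := t)).exists_bound_of_continuousOn
        (continuous_gSmooth x t).continuousOn
      exact MemLp.of_bound (continuous_gSmooth x t).aestronglyMeasurable C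
        ((ae_restrict_mem measurableSet_Icc).mono hC)
    exact h1.mono_measure (Measure.restrict_mono Ico_subset_Icc_self le_rfl)
  have h := hmem.eLpNorm_eq_integral_rpow_norm two_ne_zero ENNReal.ofNat_ne_top
  have h0 : 0 ≤ ∫ a, ‖gKernel x t a‖ ^ (2 : ℝ) := integral_nonneg fun a => by positivity
  rw [l2Norm, h, ENNReal.toReal_ofReal (by positivity), ENNReal.toReal_ofNat,
    ← Real.rpow_natCast, ← Real.rpow_mul h0]
  norm_num
  rw [intervalIntegral.integral_of_le t.coe_nonneg, ← integral_Ico_eq_integral_Ioc,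
    ← integral_indicator measurableSet_Ico]
  refine integral_congr_ae (ae_of_all _ fun s => ?_)
  by_cases hs : s ∈ Ico (0 : ℝ) t <;> simp [hK, hs]

theorem l2Norm_gKernel_pos (x : ℝ) {t : ℝ≥0} (ht : 0 < t) : 0 < l2Norm (gKernel x t) := by
  have h : 0 < l2Norm (gKernel x t) ^ 2 := by
    rw [l2Norm_gKernel_sq]
    refine intervalIntegral.intervalIntegral_pos_of_pos_on
      (((continuous_gSmooth x t).pow 2).intervalIntegrable _ _) (fun s hs => ?_) ht
    have : 0 < t - s := by linarith [hs.2]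
    unfold gSmooth
    positivity
  exact lt_of_le_of_ne ENNReal.toReal_nonneg fun h0 => by rw [← h0] at h; simp at h

end Pathwise

/-! ### Characteristic functions -/

section Probability
variable {Ω : Type*} [MeasurableSpace Ω] {P : Measure Ω}

/-- The left-point sums of a real Brownian motion are sums of independent centred Gaussians. -/
theorem charFun_stochSum_real [IsProbabilityMeasure P] {B : ℝ≥0 → Ω → ℝ}
    (hB : IsPreBrownianReal B P) (x : ℝ) (t : ℝ≥0) (N : ℕ) (u : ℝ) :
    charFun (P.map (fun ω => stochSum x t (fun s => B s ω) N)) u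
      = Complex.exp ((-(u ^ 2 / 2) * ∑ j ∈ Finset.range N,
        gSmooth x t (t * (j : ℕ) / N) ^ 2 * (t / N) : ℝ) : ℂ) := by
  have hmono : Monotone (fun j : ℕ => t * (j : ℝ≥0) / N) := fun i j hij => by
    dsimp only; gcongr
  have hindep := hB.hasIndepIncrements.nat hmono
  set c : ℕ → ℝ := fun j => gSmooth x t (t * (j : ℕ) / N) with hc
  set I : ℕ → Ω → ℝ := fun j ω => B (t * (j + 1 : ℕ) / N) ω - B (t * (j : ℕ) / N) ω with hI
  have hIm : ∀ j, AEMeasurable (I j) P := fun j => (hB.aemeasurable _).sub (hB.aemeasurable _)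
  have hindep' : iIndepFun (fun j ω => c j * I j ω) P :=
    hindep.comp (fun j y => c j * y) (fun j => by fun_prop)
  have hsum : (fun ω => stochSum x t (fun s => B s ω) N)
      = fun ω => ∑ j ∈ Finset.range N, c j * I j ω := by
    ext ω; simp [stochSum, hc, hI]
  rw [hsum, iIndepFun.charFun_map_fun_finsetSum_eq_prod
    (fun j _ => (hIm j).const_mul (c j)) (hindep'.restrict _), Finset.prod_apply]
  have hterm : ∀ j, charFun (P.map (fun ω => c j * I j ω)) u
      = Complex.exp ((-(u ^ 2 / 2) * (c j ^ 2 * (t / N)) : ℝ) : ℂ) := by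
    intro j
    have hlaw := hB.hasLaw_sub (t * (j + 1 : ℕ) / N) (t * (j : ℕ) / N)
    have hd : ((nndist ((t * (j + 1 : ℕ) / N : ℝ≥0) : ℝ) ((t * (j : ℕ) / N : ℝ≥0) : ℝ) : ℝ≥0) : ℝ)
        = t / N := by
      rw [coe_nndist, Real.dist_eq]
      push_cast
      rw [← sub_div, ← mul_sub, add_sub_cancel_left, mul_one, abs_of_nonneg (by positivity)]
    rw [charFun_map_mul_comp (hIm j), show I j = B (t * (j + 1 : ℕ) / N) - B (t * (j : ℕ) / N)
      from rfl, hlaw.map_eq, charFun_gaussianReal]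
    have hd' : ((nndist ((t * (j + 1 : ℕ) / N : ℝ≥0) : ℝ)
        ((t * (j : ℕ) / N : ℝ≥0) : ℝ) : ℝ≥0) : ℂ) = ((t / N : ℝ) : ℂ) := congrArg Complex.ofReal hd
    -- `nndist s.1 t.1` in `hasLaw_sub` is stated with subtype projections, not with coercions.
    erw [hd']
    congr 1
    push_cast
    ring
  rw [Finset.prod_congr rfl fun j _ => hterm j, ← Complex.exp_sum, Finset.mul_sum]
  push_cast
  rfl

theorem measurable_stochSum {d : ℕ} {W : ℝ≥0 → Ω → EuclideanSpace ℝ (Fin d)}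
    (hW : ∀ t, Measurable (W t)) (x : ℝ) (t : ℝ≥0) (N : ℕ) :
    Measurable (fun ω => stochSum x t (fun s => W s ω) N) := by
  unfold stochSum
  fun_prop

theorem charFun_stochSum [IsProbabilityMeasure P] {d : ℕ} {W : ℝ≥0 → Ω → EuclideanSpace ℝ (Fin d)}
    (hW : IsBrownianMotion P W) (x : ℝ) (t : ℝ≥0) (N : ℕ) (k : EuclideanSpace ℝ (Fin d)) :
    charFun (P.map (fun ω => stochSum x t (fun s => W s ω) N)) k
      = Complex.exp ((-(‖k‖ ^ 2 / 2) * ∑ j ∈ Finset.range N,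
        gSmooth x t (t * (j : ℕ) / N) ^ 2 * (t / N) : ℝ) : ℂ) := by
  set S : Fin d → Ω → ℝ := fun i ω => stochSum x t (fun s => W s ω i) N with hS
  have hmeas : ∀ i, Measurable (S i) := fun i => by
    have : ∀ s, Measurable (W s) := hW.measurable
    simp only [hS, stochSum]
    fun_prop
  have hindep : iIndepFun S P := hW.indep.comp (fun _ w => stochSum x t w N) fun i => by
    unfold stochSum; fun_prop
  have hcoord : (fun ω => stochSum x t (fun s => W s ω) N)
      = fun ω => WithLp.toLp 2 (fun i => S i ω) := by
    ext ω i
    simp [stochSum, hS]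
  rw [hcoord, (iIndepFun_iff_charFun_pi (fun i => (hmeas i).aemeasurable)).1 hindep]
  simp_rw [hS, charFun_stochSum_real (hW.brownian _).toIsPreBrownianReal]
  rw [← Complex.exp_sum, EuclideanSpace.norm_sq_eq]
  simp_rw [Real.norm_eq_abs, sq_abs]
  rw [← Complex.ofReal_sum, ← Finset.sum_mul, Finset.sum_neg_distrib, Finset.sum_div]

/-- Mixing over an independent variance: if `S` is centred Gaussian with covariance `v • 1` and
independent of `Y ≥ 0`, then conditionally on `Y` the vector `√Y S` has covariance `Y v • 1`. -/
theorem integral_cexp_sqrt_smul [IsProbabilityMeasure P] {d : ℕ} {Y : Ω → ℝ}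
    {S : Ω → EuclideanSpace ℝ (Fin d)}
    (hY : Measurable Y) (hY0 : ∀ᵐ ω ∂P, 0 ≤ Y ω) (hS : Measurable S) (hYS : IndepFun Y S P) {v : ℝ}
    (hchar : ∀ k, charFun (P.map S) k = Complex.exp ((-(‖k‖ ^ 2 / 2) * v : ℝ) : ℂ))
    (k : EuclideanSpace ℝ (Fin d)) :
    ∫ ω, Complex.exp ((inner ℝ (Real.sqrt (Y ω) • S ω) k : ℝ) * Complex.I) ∂P
      = ∫ ω, Complex.exp ((-(‖k‖ ^ 2 / 2 * v * Y ω) : ℝ) : ℂ) ∂P := by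
  have := Measure.isProbabilityMeasure_map (μ := P) hS.aemeasurable
  have := Measure.isProbabilityMeasure_map (μ := P) hY.aemeasurable
  set F : ℝ × EuclideanSpace ℝ (Fin d) → ℂ := fun p =>
    Complex.exp ((inner ℝ (Real.sqrt p.1 • p.2) k : ℝ) * Complex.I) with hF
  have hFc : Continuous F := by simp only [hF]; fun_prop
  have hprod := (indepFun_iff_map_prod_eq_prod_map_map hY.aemeasurable hS.aemeasurable).1 hYS
  have h1 : ∫ ω, F (Y ω, S ω) ∂P = ∫ p, F p ∂(P.map fun ω => (Y ω, S ω)) :=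
    (integral_map (hY.prodMk hS).aemeasurable hFc.aestronglyMeasurable).symm
  have hint : Integrable F ((P.map Y).prod (P.map S)) :=
    Integrable.of_bound hFc.aestronglyMeasurable 1
      (ae_of_all _ fun p => (Complex.norm_exp_ofReal_mul_I _).le)
  change ∫ ω, F (Y ω, S ω) ∂P = _
  rw [h1, hprod, integral_prod _ hint]
  have h2 : ∀ y : ℝ, ∫ s, F (y, s) ∂(P.map S)
      = Complex.exp ((-(‖Real.sqrt y • k‖ ^ 2 / 2) * v : ℝ) : ℂ) := by
    intro y
    rw [← hchar, charFun_apply]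
    simp only [hF, real_inner_smul_left, real_inner_smul_right]
  simp_rw [h2]
  rw [integral_map hY.aemeasurable (by fun_prop)]
  refine integral_congr_ae ?_
  filter_upwards [hY0] with ω hω
  rw [norm_smul, mul_pow, Real.norm_of_nonneg (Real.sqrt_nonneg _), Real.sq_sqrt hω]
  congr 2
  ring

theorem ae_nonneg_of_hasLaw_wrightLaw {β : ℝ} {Y : Ω → ℝ} (hY : HasLaw Y (wrightLaw β) P) :
    ∀ᵐ ω ∂P, 0 ≤ Y ω := by
  have h : ∀ᵐ y ∂(P.map Y), 0 ≤ y := by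
    rw [hY.map_eq]
    refine (withDensity_absolutelyContinuous _ _).ae_le ?_
    exact ae_restrict_mem measurableSet_Ici
  exact ae_of_ae_map hY.aemeasurable h

variable {d : ℕ} {β x : ℝ} {W X Q : ℝ≥0 → Ω → EuclideanSpace ℝ (Fin d)} {Y : Ω → ℝ}

theorem ae_tendsto_stochSum (hW : IsBrownianMotion P W) (hX : IsOrnsteinUhlenbeck P x W X)
    (hQ : SolvesQEquation P x X Q) (t : ℝ≥0) :
    ∀ᵐ ω ∂P, Tendsto (fun N => stochSum x t (fun s => W s ω) N) atTop (𝓝 (Q t ω)) := by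
  have h0 : ∀ᵐ ω ∂P, ∀ i, W 0 ω i = 0 :=
    ae_all_iff.2 fun i => (hW.brownian i).eval_zero_ae_eq_zero
  filter_upwards [h0, hX, hQ] with ω h0 hX hQ
  obtain ⟨hwc, hQt⟩ := eq_integral_gSlope_smul hX.1 hQ.1 hX.2 hQ.2 t
  rw [hQt]
  exact tendsto_stochSum hwc (by ext i; simpa using h0 i) t

/-- No measurability of `Q t` is assumed: it is an almost sure limit of left-point sums. -/
theorem aemeasurable_sqrt_smul (hW : IsBrownianMotion P W) (hX : IsOrnsteinUhlenbeck P x W X)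
    (hQ : SolvesQEquation P x X Q) (hY : Measurable Y) (t : ℝ≥0) :
    AEMeasurable (fun ω => Real.sqrt (Y ω) • Q t ω) P :=
  (Real.continuous_sqrt.measurable.comp hY).aemeasurable.smul
    (aemeasurable_of_tendsto_metrizable_ae atTop
      (fun N => (measurable_stochSum hW.measurable x t N).aemeasurable)
      (ae_tendsto_stochSum hW hX hQ t))

theorem charFun_sqrt_smul_eq_integral [IsProbabilityMeasure P] (hW : IsBrownianMotion P W)
    (hX : IsOrnsteinUhlenbeck P x W X) (hQ : SolvesQEquation P x X Q) (hYm : Measurable Y)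
    (hY0 : ∀ᵐ ω ∂P, 0 ≤ Y ω) (hYW : IndepFun Y (fun (ω : Ω) (t : ℝ≥0) => W t ω) P)
    (t : ℝ≥0) (k : EuclideanSpace ℝ (Fin d)) :
    charFun (P.map (fun ω => Real.sqrt (Y ω) • Q t ω)) k
      = ∫ ω, Complex.exp ((-(‖k‖ ^ 2 / 2 * l2Norm (gKernel x t) ^ 2 * Y ω) : ℝ) : ℂ) ∂P := by
  set v : ℕ → ℝ := fun N => ∑ j ∈ Finset.range N,
    gSmooth x t (t * (j : ℕ) / N) ^ 2 * (t / N) with hv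
  have hv0 : ∀ N, 0 ≤ v N := fun N => Finset.sum_nonneg fun j _ => by positivity
  have hS := measurable_stochSum hW.measurable x t
  rw [charFun_apply, integral_map (aemeasurable_sqrt_smul hW hX hQ hYm t) (by fun_prop)]
  have hN : ∀ N, ∫ ω, Complex.exp ((inner ℝ (Real.sqrt (Y ω)
        • stochSum x t (fun s => W s ω) N) k : ℝ) * Complex.I) ∂P
      = ∫ ω, Complex.exp ((-(‖k‖ ^ 2 / 2 * v N * Y ω) : ℝ) : ℂ) ∂P := fun N =>
    integral_cexp_sqrt_smul hYm hY0 (hS N)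
      (hYW.comp (φ := id) (ψ := fun w => stochSum x t w N) measurable_id
        (by unfold stochSum; fun_prop)) (charFun_stochSum hW x t N) k
  refine tendsto_nhds_unique (f := fun N => ∫ ω, Complex.exp ((inner ℝ (Real.sqrt (Y ω)
    • stochSum x t (fun s => W s ω) N) k : ℝ) * Complex.I) ∂P) (l := atTop) ?_ ?_
  · refine tendsto_integral_of_dominated_convergence (fun _ => 1) (fun N => ?_)
      (integrable_const 1) (fun N => ae_of_all _ fun ω => (Complex.norm_exp_ofReal_mul_I _).le) ?_
    · have := hS N
      exact Measurable.aestronglyMeasurable (by fun_prop)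
    · filter_upwards [ae_tendsto_stochSum hW hX hQ t] with ω hω
      have hc : Continuous (fun q : EuclideanSpace ℝ (Fin d) =>
        Complex.exp ((inner ℝ (Real.sqrt (Y ω) • q) k : ℝ) * Complex.I)) := by fun_prop
      exact (hc.tendsto _).comp hω
  · simp_rw [hN]
    refine tendsto_integral_of_dominated_convergence (fun _ => 1) (fun N => ?_)
      (integrable_const 1) (fun N => ?_) ?_
    · exact Measurable.aestronglyMeasurable (by fun_prop)
    · filter_upwards [hY0] with ω hω
      have := hv0 N
      rw [Complex.norm_exp, Complex.ofReal_re]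
      exact Real.exp_le_one_iff.2 (neg_nonpos.2 (by positivity))
    · refine ae_of_all _ fun ω => ?_
      have hlim : Tendsto v atTop (𝓝 (l2Norm (gKernel x t) ^ 2)) := by
        rw [l2Norm_gKernel_sq]; exact tendsto_sum_gSmooth_sq x t
      have hc : Continuous (fun u : ℝ =>
        Complex.exp ((-(‖k‖ ^ 2 / 2 * u * Y ω) : ℝ) : ℂ)) := by fun_prop
      exact (hc.tendsto _).comp hlim

theorem integral_cexp_of_hasLaw_wrightLaw [IsProbabilityMeasure P] (hβ : 0 < β) (hβ' : β < 1)
    (hY : HasLaw Y (wrightLaw β) P) (s : ℝ) :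
    ∫ ω, Complex.exp ((-(s * Y ω) : ℝ) : ℂ) ∂P = mittagLeffler β ((-s : ℝ) : ℂ) := by
  have : IsProbabilityMeasure (wrightLaw β) := by
    rw [← hY.map_eq]; exact Measure.isProbabilityMeasure_map hY.aemeasurable
  rw [mittagLeffler_eq_integral hβ hβ', ← integral_wrightLaw hβ hβ' fun z => Real.exp (-(s * z)),
    ← hY.map_eq, integral_map hY.aemeasurable (by fun_prop), ← integral_complex_ofReal]
  simp

end Probability

/-! ### The density -/

section Density
variable {d : ℕ}

/-- The density of the centred Gaussian law on `ℝᵈ` with covariance `τ • 1`. -/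
noncomputable def heatKernel (τ : ℝ) (y : EuclideanSpace ℝ (Fin d)) : ℝ :=
  (2 * Real.pi * τ) ^ (-(d : ℝ) / 2) * Real.exp (-(1 / (2 * τ)) * ‖y‖ ^ 2)

theorem measurable_heatKernel :
    Measurable (fun p : EuclideanSpace ℝ (Fin d) × ℝ => heatKernel p.2 p.1) := by
  unfold heatKernel; fun_prop

theorem heatKernel_nonneg {τ : ℝ} (hτ : 0 < τ) (y : EuclideanSpace ℝ (Fin d)) :
    0 ≤ heatKernel τ y := by
  unfold heatKernel; positivity

theorem integral_heatKernel_mul_cexp {τ : ℝ} (hτ : 0 < τ) (k : EuclideanSpace ℝ (Fin d)) :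
    ∫ y, (heatKernel τ y : ℂ) * Complex.exp ((inner ℝ y k : ℝ) * Complex.I)
      = Complex.exp ((-(‖k‖ ^ 2 / 2 * τ) : ℝ) : ℂ) := by
  have hb : 0 < ((1 / (2 * τ) : ℝ) : ℂ).re := by rw [Complex.ofReal_re]; positivity
  have h := GaussianFourier.integral_cexp_neg_mul_sq_norm_add hb Complex.I k
  have e : ∀ y : EuclideanSpace ℝ (Fin d), (heatKernel τ y : ℂ)
        * Complex.exp ((inner ℝ y k : ℝ) * Complex.I)
      = (((2 * Real.pi * τ) ^ (-(d : ℝ) / 2) : ℝ) : ℂ)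
        * Complex.exp (-((1 / (2 * τ) : ℝ) : ℂ) * ‖y‖ ^ 2 + Complex.I * (inner ℝ k y : ℝ)) := by
    intro y
    rw [heatKernel, Complex.exp_add, real_inner_comm]
    push_cast
    ring_nf
  simp_rw [e]
  rw [integral_const_mul, h, finrank_euclideanSpace_fin]
  have e2 : (Real.pi / ((1 / (2 * τ) : ℝ) : ℂ)) ^ ((d : ℂ) / 2)
      = (((2 * Real.pi * τ) ^ ((d : ℝ) / 2) : ℝ) : ℂ) := by
    rw [Complex.ofReal_cpow (by positivity)]
    push_cast
    congr 1
    field_simp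
  rw [e2, ← mul_assoc, ← Complex.ofReal_mul, ← Real.rpow_add (by positivity), neg_div,
    neg_add_cancel, Real.rpow_zero, Complex.ofReal_one, one_mul, Complex.I_sq]
  congr 1
  push_cast
  field_simp
  norm_num

theorem integrable_heatKernel {τ : ℝ} (hτ : 0 < τ) :
    Integrable (heatKernel τ : EuclideanSpace ℝ (Fin d) → ℝ) := by
  have hb : 0 < ((1 / (2 * τ) : ℝ) : ℂ).re := by rw [Complex.ofReal_re]; positivity
  have h := (GaussianFourier.integrable_cexp_neg_mul_sq_norm_add hb 0
    (0 : EuclideanSpace ℝ (Fin d))).norm.const_mul ((2 * Real.pi * τ) ^ (-(d : ℝ) / 2))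
  refine h.congr (ae_of_all _ fun y => ?_)
  simp only [heatKernel, zero_mul, add_zero, Complex.norm_exp]
  rw [← Complex.ofReal_pow, ← Complex.ofReal_neg, ← Complex.ofReal_mul, Complex.ofReal_re]

theorem integral_heatKernel {τ : ℝ} (hτ : 0 < τ) :
    ∫ y : EuclideanSpace ℝ (Fin d), heatKernel τ y = 1 := by
  have h := integral_heatKernel_mul_cexp hτ (0 : EuclideanSpace ℝ (Fin d))
  simp only [inner_zero_right, Complex.ofReal_zero, zero_mul, Complex.exp_zero, mul_one, norm_zero,
    integral_complex_ofReal] at h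
  norm_num at h
  exact_mod_cast h

/-- Away from the origin the factor `e^{-‖y‖² / (2τ)}` compensates the singularity at `τ = 0`. -/
theorem exists_heatKernel_le {y : EuclideanSpace ℝ (Fin d)} (hy : y ≠ 0) :
    ∃ C, ∀ τ, 0 < τ → heatKernel τ y ≤ C := by
  have ha : 0 < ‖y‖ ^ 2 / 2 := by have := norm_pos_iff.2 hy; positivity
  set a := ‖y‖ ^ 2 / 2 with ha'
  refine ⟨(2 * Real.pi) ^ (-(d : ℝ) / 2) * (1 + d.factorial / a ^ d), fun τ hτ => ?_⟩
  set u := τ⁻¹ with hu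
  have hu0 : 0 < u := inv_pos.2 hτ
  have h1 : heatKernel τ y
      = (2 * Real.pi) ^ (-(d : ℝ) / 2) * (u ^ ((d : ℝ) / 2) * Real.exp (-(a * u))) := by
    rw [heatKernel, Real.mul_rpow (by positivity) hτ.le, hu, Real.inv_rpow hτ.le,
      ← Real.rpow_neg hτ.le, ha', neg_div, mul_assoc]
    congr 3
    field_simp
  have h2 : u ^ ((d : ℝ) / 2) ≤ 1 + u ^ d := by
    rcases le_total u 1 with h | h
    · have := Real.rpow_le_one hu0.le h (show (0 : ℝ) ≤ (d : ℝ) / 2 by positivity)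
      have : 0 ≤ u ^ d := by positivity
      linarith
    · have := Real.rpow_le_rpow_of_exponent_le h (half_le_self (Nat.cast_nonneg (α := ℝ) d))
      rw [Real.rpow_natCast] at this
      linarith
  have h3 : u ^ d * Real.exp (-(a * u)) ≤ d.factorial / a ^ d := by
    have h := Real.pow_div_factorial_le_exp (a * u) (by positivity) d
    rw [div_le_iff₀ (by positivity), mul_pow] at h
    rw [Real.exp_neg, ← div_eq_mul_inv, div_le_div_iff₀ (Real.exp_pos _) (by positivity)]
    linarith
  have h4 : Real.exp (-(a * u)) ≤ 1 := Real.exp_le_one_iff.2 (neg_nonpos.2 (by positivity))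
  rw [h1]
  refine mul_le_mul_of_nonneg_left ?_ (by positivity)
  calc _ ≤ (1 + u ^ d) * Real.exp (-(a * u)) := by gcongr
    _ = Real.exp (-(a * u)) + u ^ d * Real.exp (-(a * u)) := by ring
    _ ≤ _ := add_le_add h4 h3

variable {m : ℝ → ℝ}

theorem integrable_heatKernel_mul (hm : IntegrableOn m (Ioi 0)) :
    Integrable (fun p : EuclideanSpace ℝ (Fin d) × ℝ => heatKernel p.2 p.1 * m p.2)
      (volume.prod (volume.restrict (Ioi 0))) := by
  have hmeas : AEStronglyMeasurable
      (fun p : EuclideanSpace ℝ (Fin d) × ℝ => heatKernel p.2 p.1 * m p.2)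
      (volume.prod (volume.restrict (Ioi 0))) :=
    measurable_heatKernel.aestronglyMeasurable.mul hm.aestronglyMeasurable.comp_snd
  rw [integrable_prod_iff' hmeas]
  refine ⟨?_, ?_⟩
  · filter_upwards [ae_restrict_mem measurableSet_Ioi] with τ hτ
    exact (integrable_heatKernel hτ).mul_const _
  · refine IntegrableOn.congr_fun hm.norm (fun τ hτ => ?_) measurableSet_Ioi
    simp only [norm_mul]
    rw [integral_mul_const]
    simp_rw [Real.norm_of_nonneg (heatKernel_nonneg hτ _)]
    rw [integral_heatKernel hτ, one_mul]

/-- The characteristic function of a mixture of centred Gaussian laws with mixing density `m`. -/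
theorem charFun_withDensity_mixture (hm : IntegrableOn m (Ioi 0))
    (hm0 : ∀ τ, 0 < τ → 0 ≤ m τ) (k : EuclideanSpace ℝ (Fin d)) :
    charFun (volume.withDensity fun y : EuclideanSpace ℝ (Fin d) =>
      ENNReal.ofReal (∫ τ in Ioi (0 : ℝ), heatKernel τ y * m τ)) k
      = ((∫ τ in Ioi (0 : ℝ), Real.exp (-(‖k‖ ^ 2 / 2 * τ)) * m τ : ℝ) : ℂ) := by
  have hint := integrable_heatKernel_mul (d := d) hm
  have hρ := hint.integral_prod_left
  have hρ0 : ∀ y : EuclideanSpace ℝ (Fin d), 0 ≤ ∫ τ in Ioi (0 : ℝ), heatKernel τ y * m τ := by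
    intro y
    refine integral_nonneg_of_ae ?_
    filter_upwards [ae_restrict_mem measurableSet_Ioi] with τ hτ
    exact mul_nonneg (heatKernel_nonneg hτ y) (hm0 τ hτ)
  have hintc : Integrable (fun p : EuclideanSpace ℝ (Fin d) × ℝ =>
      ((heatKernel p.2 p.1 * m p.2 : ℝ) : ℂ) * Complex.exp ((inner ℝ p.1 k : ℝ) * Complex.I))
      (volume.prod (volume.restrict (Ioi 0))) := by
    refine Integrable.mul_bdd (c := 1) hint.ofReal
      (Continuous.aestronglyMeasurable (by fun_prop)) ?_
    exact ae_of_all _ fun p => (Complex.norm_exp_ofReal_mul_I _).le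
  rw [charFun_apply, integral_withDensity_eq_integral_toReal_smul₀
    hρ.aestronglyMeasurable.aemeasurable.ennreal_ofReal
    (ae_of_all _ fun t => ENNReal.ofReal_lt_top)]
  have e1 : ∀ y : EuclideanSpace ℝ (Fin d),
      (ENNReal.ofReal (∫ τ in Ioi (0 : ℝ), heatKernel τ y * m τ)).toReal
        • Complex.exp ((inner ℝ y k : ℝ) * Complex.I)
      = ∫ τ in Ioi (0 : ℝ), ((heatKernel τ y * m τ : ℝ) : ℂ)
        * Complex.exp ((inner ℝ y k : ℝ) * Complex.I) := by
    intro y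
    rw [ENNReal.toReal_ofReal (hρ0 y), integral_mul_const, integral_complex_ofReal,
      Complex.real_smul]
  simp_rw [e1]
  rw [integral_integral_swap hintc, ← integral_complex_ofReal]
  refine setIntegral_congr_fun measurableSet_Ioi fun τ hτ => ?_
  have e2 : ∀ y : EuclideanSpace ℝ (Fin d), ((heatKernel τ y * m τ : ℝ) : ℂ)
        * Complex.exp ((inner ℝ y k : ℝ) * Complex.I)
      = ((heatKernel τ y : ℂ) * Complex.exp ((inner ℝ y k : ℝ) * Complex.I)) * m τ := fun y => by
    push_cast; ring
  simp_rw [e2]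
  rw [integral_mul_const, integral_heatKernel_mul_cexp hτ]
  push_cast
  rfl

theorem wrightKernel_eq {β G τ : ℝ} (hβ : 0 < β) (hG : 0 < G) (hτ : 0 < τ)
    (y : EuclideanSpace ℝ (Fin d)) :
    wrightKernel β d (Real.sqrt 2 • y) (G ^ (2 / β)) τ
      = ((2 * Real.pi) ^ ((d : ℝ) / 2) / (4 * Real.pi) ^ ((d : ℝ) / 2))
        * (heatKernel τ y * ((G ^ 2)⁻¹ * wrightM β ((G ^ 2)⁻¹ * τ))) := by
  have h1 : (G ^ (2 / β)) ^ (-β) = (G ^ 2)⁻¹ := by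
    rw [← Real.rpow_mul hG.le, show 2 / β * -β = -((2 : ℕ) : ℝ) by push_cast; field_simp,
      Real.rpow_neg hG.le, Real.rpow_natCast]
  have h2 : ‖Real.sqrt 2 • y‖ ^ 2 = 2 * ‖y‖ ^ 2 := by
    rw [norm_smul, mul_pow, Real.norm_of_nonneg (Real.sqrt_nonneg _), Real.sq_sqrt zero_le_two]
  have h3 : Real.exp (-(2 * ‖y‖ ^ 2) / (4 * τ)) = Real.exp (-(1 / (2 * τ)) * ‖y‖ ^ 2) := by
    congr 1; field_simp; ring
  rw [wrightKernel, heatKernel, h1, h2, h3, mul_comm τ, Real.mul_rpow (x := 4 * Real.pi)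
    (by positivity) hτ.le, Real.mul_rpow (x := 2 * Real.pi) (by positivity) hτ.le, neg_div,
    Real.rpow_neg (x := 2 * Real.pi) (by positivity), Real.rpow_neg hτ.le]
  have p1 : (2 * Real.pi) ^ ((d : ℝ) / 2) ≠ 0 := by positivity
  have p2 : (4 * Real.pi) ^ ((d : ℝ) / 2) ≠ 0 := by positivity
  have p3 : τ ^ ((d : ℝ) / 2) ≠ 0 := by positivity
  field_simp

/-- The density of the statement is the mixture of heat kernels with mixing density
`τ ↦ G⁻² M_β(G⁻² τ)`. -/
theorem density_eq {β G : ℝ} (hβ : 0 < β) (hG : 0 < G) (y : EuclideanSpace ℝ (Fin d)) :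
    (2 * Real.pi) ^ (-(d : ℝ) / 2) * (1 / 2 * (4 * Real.pi) ^ ((d : ℝ) / 2) *
        wrightMM β d (Real.sqrt 2 • y) (G ^ (2 / β)))
      = ∫ τ in Ioi (0 : ℝ), heatKernel τ y * ((G ^ 2)⁻¹ * wrightM β ((G ^ 2)⁻¹ * τ)) := by
  rw [wrightMM, setIntegral_congr_fun measurableSet_Ioi fun τ hτ => wrightKernel_eq hβ hG hτ y,
    integral_const_mul, neg_div, Real.rpow_neg (by positivity)]
  have p1 : (2 * Real.pi) ^ ((d : ℝ) / 2) ≠ 0 := by positivity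
  have p2 : (4 * Real.pi) ^ ((d : ℝ) / 2) ≠ 0 := by positivity
  field_simp

theorem integrableOn_scaled_wrightM {β c : ℝ} (hβ : 0 < β) (hβ' : β < 1) (hc : 0 < c) :
    IntegrableOn (fun τ => c * wrightM β (c * τ)) (Ioi 0) := by
  have h := (integrableOn_Ioi_comp_mul_left_iff (wrightM β) 0 hc).2
    (by rw [mul_zero]; exact integrableOn_wrightM hβ hβ')
  exact h.const_mul c

theorem integrableOn_wrightKernel {β G : ℝ} (hβ : 0 < β) (hβ' : β < 1) (hG : 0 < G)
    {y : EuclideanSpace ℝ (Fin d)} (hy : y ≠ 0) :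
    IntegrableOn (wrightKernel β d (Real.sqrt 2 • y) (G ^ (2 / β))) (Ioi 0) := by
  obtain ⟨C, hC⟩ := exists_heatKernel_le hy
  have hm := integrableOn_scaled_wrightM hβ hβ' (c := (G ^ 2)⁻¹) (by positivity)
  have h : IntegrableOn (fun τ => heatKernel τ y * ((G ^ 2)⁻¹ * wrightM β ((G ^ 2)⁻¹ * τ)))
      (Ioi 0) := by
    refine Integrable.bdd_mul (c := C) hm
      (measurable_heatKernel.comp measurable_prodMk_left).aestronglyMeasurable ?_
    filter_upwards [ae_restrict_mem measurableSet_Ioi] with τ hτ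
    rw [Real.norm_of_nonneg (heatKernel_nonneg hτ y)]
    exact hC τ hτ
  exact IntegrableOn.congr_fun (h.const_mul _)
    (fun τ hτ => (wrightKernel_eq hβ hG hτ y).symm) measurableSet_Ioi

end Density

end GreyOU

theorem proposition3p6 {Ω : Type*} [MeasurableSpace Ω] (P : Measure Ω) [IsProbabilityMeasure P]
    (d : ℕ) (β x : ℝ) (hβ : 0 < β) (hβ' : β < 1) (hx : 0 ≤ x)
    (W X Q : ℝ≥0 → Ω → EuclideanSpace ℝ (Fin d)) (Y : Ω → ℝ)
    (hW : GreyOU.IsBrownianMotion P W)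
    (hX : GreyOU.IsOrnsteinUhlenbeck P x W X)
    (hQ : GreyOU.SolvesQEquation P x X Q)
    (hYm : Measurable Y)
    (hY : HasLaw Y (GreyOU.wrightLaw β) P)
    (hYW : IndepFun Y (fun (ω : Ω) (t : ℝ≥0) => W t ω) P) :
    (∀ (t : ℝ≥0) (k : EuclideanSpace ℝ (Fin d)),
      charFun (P.map (fun ω => Real.sqrt (Y ω) • Q t ω)) k
        = GreyOU.mittagLeffler β
            ((-(‖k‖ ^ 2 / 2) * GreyOU.l2Norm (GreyOU.gKernel x t) ^ 2 : ℝ) : ℂ)) ∧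
    (∀ t : ℝ≥0, 0 < t →
      (∀ y : EuclideanSpace ℝ (Fin d), y ≠ 0 →
        IntegrableOn (GreyOU.wrightKernel β d (Real.sqrt 2 • y)
          (GreyOU.l2Norm (GreyOU.gKernel x t) ^ (2 / β))) (Ioi 0)) ∧
      HasLaw (fun ω => Real.sqrt (Y ω) • Q t ω)
        (volume.withDensity (fun y => ENNReal.ofReal
          ((2 * Real.pi) ^ (-(d : ℝ) / 2) *
            (1 / 2 * (4 * Real.pi) ^ ((d : ℝ) / 2) *
              GreyOU.wrightMM β d (Real.sqrt 2 • y)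
                (GreyOU.l2Norm (GreyOU.gKernel x t) ^ (2 / β)))))) P) := by
  have hY0 := GreyOU.ae_nonneg_of_hasLaw_wrightLaw hY
  have hprob : IsProbabilityMeasure (GreyOU.wrightLaw β) := by
    rw [← hY.map_eq]; exact Measure.isProbabilityMeasure_map hY.aemeasurable
  have hchar : ∀ (t : ℝ≥0) (k : EuclideanSpace ℝ (Fin d)),
      charFun (P.map (fun ω => Real.sqrt (Y ω) • Q t ω)) k
        = GreyOU.mittagLeffler β
            ((-(‖k‖ ^ 2 / 2 * GreyOU.l2Norm (GreyOU.gKernel x t) ^ 2) : ℝ) : ℂ) := fun t k => by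
    rw [GreyOU.charFun_sqrt_smul_eq_integral hW hX hQ hYm hY0 hYW,
      GreyOU.integral_cexp_of_hasLaw_wrightLaw hβ hβ' hY]
  refine ⟨fun t k => by rw [hchar, neg_mul], fun t ht => ?_⟩
  have hG := GreyOU.l2Norm_gKernel_pos x ht
  refine ⟨fun y hy => GreyOU.integrableOn_wrightKernel hβ hβ' hG hy,
    GreyOU.aemeasurable_sqrt_smul hW hX hQ hYm t, ?_⟩
  simp_rw [GreyOU.density_eq hβ hG]
  set G := GreyOU.l2Norm (GreyOU.gKernel x t) with hGdef
  have hc : 0 < (G ^ 2)⁻¹ := by positivity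
  have hm := GreyOU.integrableOn_scaled_wrightM hβ hβ' hc
  have hm0 : ∀ τ : ℝ, 0 < τ → 0 ≤ (G ^ 2)⁻¹ * GreyOU.wrightM β ((G ^ 2)⁻¹ * τ) := fun τ hτ =>
    mul_nonneg hc.le (GreyOU.wrightM_nonneg hβ hβ' (mul_pos hc hτ))
  have := Measure.isProbabilityMeasure_map (GreyOU.aemeasurable_sqrt_smul hW hX hQ hYm t)
  have := isFiniteMeasure_withDensity_ofReal
    (GreyOU.integrable_heatKernel_mul (d := d) hm).integral_prod_left.2
  refine Measure.ext_of_charFun (funext fun k => ?_)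
  rw [hchar, GreyOU.charFun_withDensity_mixture hm hm0, GreyOU.mittagLeffler_eq_integral hβ hβ']
  congr 1
  have hcv := integral_comp_mul_left_Ioi
    (fun τ => Real.exp (-(‖k‖ ^ 2 / 2 * G ^ 2 * τ)) * GreyOU.wrightM β τ) 0 hc
  rw [mul_zero, inv_inv, smul_eq_mul] at hcv
  have e : ∀ τ : ℝ, Real.exp (-(‖k‖ ^ 2 / 2 * τ)) * ((G ^ 2)⁻¹ * GreyOU.wrightM β ((G ^ 2)⁻¹ * τ))
      = (G ^ 2)⁻¹ * (Real.exp (-(‖k‖ ^ 2 / 2 * G ^ 2 * ((G ^ 2)⁻¹ * τ)))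
        * GreyOU.wrightM β ((G ^ 2)⁻¹ * τ)) := fun τ => by
    have : ‖k‖ ^ 2 / 2 * G ^ 2 * ((G ^ 2)⁻¹ * τ) = ‖k‖ ^ 2 / 2 * τ := by field_simp
    rw [this]; ring
  simp_rw [e]
  rw [integral_const_mul, hcv, inv_mul_cancel_left₀ (by positivity)]
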